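/- All graphs are finite, simple and undirected. A graph is $(0,1)$-ternary if it has no induced cycle whose length is congruent to $0$ or $1$ modulo $3$. A graph is $2$-connected if it has at least two vertices, is connected, and has no vertex whose removal disconnects it (so $K_2$ counts as $2$-connected). An independent dominating set of $G$ is a set of pairwise nonadjacent vertices such that every vertex of $G$ belongs to it or has a neighbor in it; $i(G)$ is the minimum size of such a set, and an $i(G)$-dominating set is an independent dominating set of size $i(G)$. Attaching an ear with distinct endpoints $u,v\in V(G)$ to $G$ means adding a path from $u$ to $v$ whose internal vertices are new (possibly there are none, in which case $u$ and $v$ are nonadjacent in $G$ and the edge $uv$ is added). For a $2$-connected $(0,1)$-ternary graph $G$, a pair $\{u,v\}\subseteq V(G)$ is admissible if some $2$-connected $(0,1)$-ternary graph can be obtained from $G$ by attaching an ear with endpoints $u$ and $v$. **Theorem 3.2.** Let $m\ge 0$ be an integer and let $G$ be a $2$-connected $(0,1)$-ternary graph on $3m+2$ vertices. Then 1. $i(G)=m+1$; 2. no $i(G)$-dominating set contains both vertices of an admissible pair; 3. $i(G-x)\ge i(G)$ for every vertex $x\in V(G)$. Moreover, for every $x\in V(G)$ there is an $i(G)$-dominating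 set containing $x$. -/

import Mathlib

namespace ZeroOneTernary

/-- `G` is `(0,1)`-ternary: no induced cycle has length congruent to `0` or `1` modulo `3`.
An induced cycle is a cycle without chords. -/
def IsZeroOneTernary {V : Type*} (G : SimpleGraph V) : Prop :=
  ∀ (a : V) (c : G.Walk a a), c.IsCycle → c.IsChordless →
    ¬(c.length % 3 = 0 ∨ c.length % 3 = 1)

/-- The graph `G - x`, obtained from `G` by deleting the vertex `x`. -/
abbrev deleteVertex {V : Type*} (G : SimpleGraph V) (x : V) : SimpleGraph ({x}ᶜ : Set V) :=
  G.induce ({x}ᶜ : Set V)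

/-- `G` is `2`-connected: it has at least two vertices, is connected, and has no vertex whose
removal disconnects it. With this convention the complete graph `K₂` counts as `2`-connected. -/
def IsTwoConnected {V : Type*} (G : SimpleGraph V) : Prop :=
  Nontrivial V ∧ G.Connected ∧ ∀ x : V, (deleteVertex G x).Connected

/-- `A` dominates `G`: every vertex lies in `A` or has a neighbor in `A`. -/
def IsDominating {V : Type*} (G : SimpleGraph V) (A : Finset V) : Prop :=
  ∀ v : V, v ∈ A ∨ ∃ w ∈ A, G.Adj v w

/-- `A` is an independent dominating set of `G`. -/
def IsIndepDominating {V : Type*} (G : SimpleGraph V) (A : Finset V) : Prop :=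
  G.IsIndepSet (A : Set V) ∧ IsDominating G A

/-- The independent domination number `i(G)`: the least size of an independent dominating set
(one exists in every finite graph, see `exists_isIndepDominating`). -/
noncomputable def indepDomNumber {V : Type*} (G : SimpleGraph V) : ℕ :=
  sInf {k : ℕ | ∃ A : Finset V, IsIndepDominating G A ∧ A.card = k}

/-- `A` is an `i(G)`-dominating set: an independent dominating set of minimum size. -/
def IsMinIndepDominating {V : Type*} (G : SimpleGraph V) (A : Finset V) : Prop :=
  IsIndepDominating G A ∧ ∀ B : Finset V, IsIndepDominating G B → A.card ≤ B.card

/-- Every finite graph has an independent dominating set, so that the infimum in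
`indepDomNumber` is a minimum. -/
theorem exists_isIndepDominating {V : Type*} [Finite V] (G : SimpleGraph V) :
    ∃ A : Finset V, IsIndepDominating G A := by
  classical
  obtain ⟨A, hA⟩ := (Set.toFinite {A : Finset V | G.IsIndepSet (A : Set V)}).exists_maximal
    ⟨∅, by simp⟩
  refine ⟨A, hA.prop, fun v => ?_⟩
  by_contra! h
  obtain ⟨hv, hn⟩ := h
  have hins : insert v A ∈ {A : Finset V | G.IsIndepSet (A : Set V)} := by
    have hA' : (A : Set V).Pairwise (fun v w => ¬G.Adj v w) := hA.prop
    simp only [Set.mem_ofPred_eq, Finset.coe_insert, SimpleGraph.isIndepSet_iff]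
    exact hA'.insert fun w hw _ => ⟨hn w hw, fun h => hn w hw h.symm⟩
  exact hv (hA.le_of_ge hins (Finset.subset_insert v A) (Finset.mem_insert_self v A))

/-- The graph obtained from `G` by attaching an ear with endpoints `u ≠ v` and `n` new internal
vertices `0, …, n - 1`, i.e. the path `u, 0, 1, …, n - 1, v` of length `n + 1`. For `n = 0` the
ear is the single edge `uv`. (`SimpleGraph.fromRel` symmetrizes the relation.) -/
def attachEar {V : Type*} (G : SimpleGraph V) (u v : V) (n : ℕ) : SimpleGraph (V ⊕ Fin n) :=
  SimpleGraph.fromRel fun a b =>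
    match a, b with
    | Sum.inl a, Sum.inl b => G.Adj a b ∨ (n = 0 ∧ a = u ∧ b = v)
    | Sum.inl a, Sum.inr i => a = u ∧ (i : ℕ) = 0
    | Sum.inr i, Sum.inr j => (i : ℕ) + 1 = j
    | Sum.inr i, Sum.inl b => (i : ℕ) + 1 = n ∧ b = v

/-- `{u, v}` is an admissible pair of `G`: `u ≠ v` and attaching to `G` some ear with endpoints
`u` and `v` gives a `2`-connected `(0,1)`-ternary graph. Graphs being simple, an ear that is a
single edge can only join nonadjacent vertices. -/
def IsAdmissiblePair {V : Type*} (G : SimpleGraph V) (u v : V) : Prop :=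
  u ≠ v ∧ ∃ n : ℕ, (n = 0 → ¬G.Adj u v) ∧
    IsTwoConnected (attachEar G u v n) ∧ IsZeroOneTernary (attachEar G u v n)

end ZeroOneTernary

namespace ZeroOneTernary

/-! A chord splits a cycle into two cycles whose lengths add up to two more than its own, so every
cycle of a $(0,1)$-ternary graph, induced or not, has length $2$ modulo $3$
(`IsZeroOneTernary.length_mod`). If $s,t$ are adjacent or admissible, the edge or ear closes the
other $s$–$t$ paths into cycles, so all $s$–$t$ paths have the same number of internal vertices
modulo $3$.

Such a graph is a series-parallel network between $s$ and $t$ (`IsTwoTerminal.exists_network`). A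
vertex separating $s$ from $t$ gives a series composition, and an edge $st$ or a disconnection by
$\{s,t\}$ a parallel one. Otherwise a path crosses between two disjoint $s$–$t$ paths, and the
resulting congruences contradict each other. Two parallel parts close up cycles, which forces their
numbers of internal vertices to be divisible by $3$.

Independent sets dominating the interior are then counted by induction on the network, recording
whether each terminal is chosen, dominated or neither. Finite tables for the two compositions give a
lower bound (`Network.le_card`) and sharpness in enough cases (`Network.exists_isConfig`). With $3m$
internal vertices, dominating $t$ costs $m+1$ vertices in all, and $m+2$ if both terminals are
chosen; $m+1$ is attained with $s$ chosen. Domination of $s$ is not needed for the bound, so it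
covers $G-s$, and any vertex can play $s$ next to a neighbor $t$. -/

/-- `l` is the list of internal vertices of a path of `E` from `u` to `v`. -/
def IsLink {V : Type*} (E : SimpleGraph V) (u : V) (l : List V) (v : V) : Prop :=
  (u :: (l ++ [v])).Nodup ∧ (u :: (l ++ [v])).IsChain E.Adj

/-! ### Paths as lists of internal vertices -/

section Link

variable {V : Type*} {E : SimpleGraph V} {u v w : V} {l l' : List V}

theorem isLink_nil_iff : IsLink E u [] v ↔ E.Adj u v := by
  simpa [IsLink] using fun h : E.Adj u v => h.ne

theorem IsLink.ne (h : IsLink E u l v) : u ≠ v := by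
  have := h.1
  grind

theorem IsLink.reverse (h : IsLink E u l v) : IsLink E v l.reverse u := by
  have e : v :: (l.reverse ++ [u]) = (u :: (l ++ [v])).reverse := by simp
  refine ⟨by rw [e]; exact List.nodup_reverse.2 h.1, ?_⟩
  rw [e, List.isChain_reverse]
  exact h.2.imp fun _ _ hab => hab.symm

theorem IsLink.mono {E' : SimpleGraph V} (hE : E ≤ E') (h : IsLink E u l v) : IsLink E' u l v :=
  ⟨h.1, h.2.imp fun _ _ hab => hE hab⟩

theorem IsLink.append (h : IsLink E u l w) (h' : IsLink E w l' v)
    (hd : ∀ x ∈ u :: l, x ∉ l' ++ [v]) : IsLink E u (l ++ w :: l') v := by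
  have e : u :: ((l ++ w :: l') ++ [v]) = (u :: l) ++ w :: (l' ++ [v]) := by simp
  have h1 := h.1
  have h2 := h'.1
  refine ⟨?_, ?_⟩
  · rw [e, List.nodup_append]
    grind
  · rw [e, List.isChain_split]
    exact ⟨by simpa using h.2, h'.2⟩

theorem IsLink.split (h : IsLink E u (l ++ w :: l') v) :
    IsLink E u l w ∧ IsLink E w l' v ∧ ∀ x ∈ u :: l, x ∉ w :: (l' ++ [v]) := by
  have e : u :: ((l ++ w :: l') ++ [v]) = (u :: l) ++ w :: (l' ++ [v]) := by simp
  have h1 := h.1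
  have h2 := h.2
  rw [e, List.nodup_append] at h1
  rw [e, List.isChain_split] at h2
  refine ⟨⟨?_, by simpa using h2.1⟩, ⟨by grind, h2.2⟩, by grind⟩
  rw [← List.cons_append, List.nodup_append]
  grind

/-- Every vertex of a link is an end of one of its edges; this confines links of a restricted graph
to its support. -/
theorem IsLink.mem_of_adj {S : Set V} (h : IsLink E u l v)
    (hS : ∀ a b, E.Adj a b → a ∈ S) {x : V} (hx : x ∈ u :: (l ++ [v])) : x ∈ S := by
  obtain ⟨A, B, hAB⟩ := List.append_of_mem hx
  have h2 := h.2
  rw [hAB, List.isChain_split] at h2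
  rcases B with _ | ⟨b, B⟩
  · rcases A.eq_nil_or_concat with rfl | ⟨A, a, rfl⟩
    · simp at hAB
    · have := h2.1
      rw [List.concat_eq_append, List.append_assoc] at this
      have := (List.isChain_append.1 this).2.1
      simp only [List.cons_append, List.nil_append, List.isChain_cons_cons] at this
      exact hS _ _ this.1.symm
  · exact hS _ _ (List.isChain_cons_cons.1 h2.2).1

theorem exists_isLink_of_reachable (h : E.Reachable u v) (hne : u ≠ v) : ∃ l, IsLink E u l v := by
  classical
  obtain ⟨p, hp⟩ := h.exists_isPath
  have h1 := hp.support_nodup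
  have h2 := p.isChain_adj_support
  have h3 : u :: p.support.tail = p.support := p.cons_tail_support
  have h4 : p.support.tail ≠ [] := by
    cases p with
    | nil => exact absurd rfl hne
    | cons h q => simp
  have h5 : p.support.tail.getLast h4 = v := by
    rw [List.getLast_tail]; simp
  have h6 : p.support = u :: (p.support.tail.dropLast ++ [v]) := by
    have h6 := List.dropLast_append_getLast h4
    rw [h5] at h6
    rw [h6, h3]
  exact ⟨p.support.tail.dropLast, h6 ▸ h1, h6 ▸ h2⟩

end Link

/-! ### Series-parallel networks -/

/-- Two-terminal series-parallel networks: `Network E S s t n` says that the graph with vertex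
set `S` and edges `E` is built from single edges by series composition and by parallel composition
of networks whose numbers of internal vertices are divisible by `3`; its terminals are `s` and `t`
and it has `n` internal vertices. -/
inductive Network {V : Type*} [DecidableEq V] :
    SimpleGraph V → Finset V → V → V → ℕ → Prop
  | edge {s t : V} (h : s ≠ t) : Network (SimpleGraph.edge s t) {s, t} s t 0
  | par {E₁ E₂ : SimpleGraph V} {S₁ S₂ : Finset V} {s t : V} {n₁ n₂ : ℕ}
      (h₁ : Network E₁ S₁ s t n₁) (h₂ : Network E₂ S₂ s t n₂) (hn₁ : n₁ % 3 = 0) (hn₂ : n₂ % 3 = 0)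
      (hS : S₁ ∩ S₂ = {s, t}) : Network (E₁ ⊔ E₂) (S₁ ∪ S₂) s t (n₁ + n₂)
  | ser {E₁ E₂ : SimpleGraph V} {S₁ S₂ : Finset V} {s w t : V} {n₁ n₂ : ℕ}
      (h₁ : Network E₁ S₁ s w n₁) (h₂ : Network E₂ S₂ w t n₂)
      (hS : S₁ ∩ S₂ = {w}) : Network (E₁ ⊔ E₂) (S₁ ∪ S₂) s t (n₁ + n₂ + 1)

section Network

variable {V : Type*} [DecidableEq V] {E E₁ E₂ : SimpleGraph V} {S S₁ S₂ J : Finset V}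
  {s t v : V} {n : ℕ}

theorem Network.left_mem (h : Network E S s t n) : s ∈ S := by
  induction h <;> simp_all

theorem Network.right_mem (h : Network E S s t n) : t ∈ S := by
  induction h <;> simp_all

theorem Network.ne (h : Network E S s t n) : s ≠ t := by
  induction h with
  | edge h => exact h
  | par _ _ _ _ _ ih _ => exact ih
  | ser h₁ h₂ hS ih₁ ih₂ =>
    rintro rfl
    have := Finset.mem_inter.2 ⟨h₁.left_mem, h₂.right_mem⟩
    rw [hS, Finset.mem_singleton] at this
    exact ih₁ this

theorem Network.mem_of_adj (h : Network E S s t n) : ∀ {a b}, E.Adj a b → a ∈ S := by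
  induction h with
  | edge h => intro a b hab; simp [SimpleGraph.edge_adj] at hab; grind
  | par _ _ _ _ _ ih₁ ih₂ => intro a b hab; exact Finset.mem_union.2 (hab.imp ih₁ ih₂)
  | ser _ _ _ ih₁ ih₂ => intro a b hab; exact Finset.mem_union.2 (hab.imp ih₁ ih₂)

theorem Network.card_eq (h : Network E S s t n) : S.card = n + 2 := by
  induction h with
  | edge h => rw [Finset.card_pair h]
  | @par _ _ S₁ S₂ _ _ _ _ h₁ _ _ _ hS ih₁ ih₂ =>
    have := Finset.card_union_add_card_inter S₁ S₂
    rw [hS, Finset.card_pair h₁.ne] at this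
    omega
  | @ser _ _ S₁ S₂ _ _ _ _ _ h₁ _ hS ih₁ ih₂ =>
    have := Finset.card_union_add_card_inter S₁ S₂
    rw [hS, Finset.card_singleton] at this
    omega

/-! ### Counting dominating sets by terminal status -/

open Classical in
/-- The status of a vertex relative to a set `J`: `2` if it belongs to `J`, `1` if it does not but
has a neighbor in `J`, and `0` otherwise. -/
noncomputable def status {V : Type*} (E : SimpleGraph V) (J : Finset V) (v : V) : Fin 3 :=
  if v ∈ J then 2 else if ∃ w ∈ J, E.Adj v w then 1 else 0

theorem status_eq_two : status E J v = 2 ↔ v ∈ J := by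
  unfold status; split_ifs <;> simp_all

theorem status_eq_zero : status E J v = 0 ↔ v ∉ J ∧ ∀ w ∈ J, ¬ E.Adj v w := by
  unfold status; split_ifs <;> simp_all

theorem status_eq_one : status E J v = 1 ↔ v ∉ J ∧ ∃ w ∈ J, E.Adj v w := by
  unfold status; split_ifs <;> simp_all

/-- At a shared vertex both parts agree on membership in `J`, and a neighbor in `J` may come from
either; the order $0<1<2$ turns gluing into a maximum. -/
theorem status_sup (h₁ : ∀ {a b}, E₁.Adj a b → a ∈ S₁) (h₂ : ∀ {a b}, E₂.Adj a b → a ∈ S₂)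
    (hv₁ : v ∈ S₁) (hv₂ : v ∈ S₂) :
    status (E₁ ⊔ E₂) J v = max (status E₁ (J ∩ S₁) v) (status E₂ (J ∩ S₂) v) := by
  by_cases hv : v ∈ J
  · rw [status_eq_two.2 hv, status_eq_two.2 (Finset.mem_inter.2 ⟨hv, hv₁⟩),
      status_eq_two.2 (Finset.mem_inter.2 ⟨hv, hv₂⟩), max_self]
  · have hv₁' : v ∉ J ∩ S₁ := fun h => hv (Finset.mem_inter.1 h).1
    have hv₂' : v ∉ J ∩ S₂ := fun h => hv (Finset.mem_inter.1 h).1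
    by_cases hx : ∃ w ∈ J ∩ S₁, E₁.Adj v w
    · have hz : ∃ w ∈ J, (E₁ ⊔ E₂).Adj v w := by
        obtain ⟨w, hw, hvw⟩ := hx
        exact ⟨w, (Finset.mem_inter.1 hw).1, Or.inl hvw⟩
      rw [status_eq_one.2 ⟨hv, hz⟩, status_eq_one.2 ⟨hv₁', hx⟩]
      by_cases hy : ∃ w ∈ J ∩ S₂, E₂.Adj v w
      · rw [status_eq_one.2 ⟨hv₂', hy⟩, max_self]
      · push Not at hy
        rw [status_eq_zero.2 ⟨hv₂', hy⟩]
        rfl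
    · by_cases hy : ∃ w ∈ J ∩ S₂, E₂.Adj v w
      · have hz : ∃ w ∈ J, (E₁ ⊔ E₂).Adj v w := by
          obtain ⟨w, hw, hvw⟩ := hy
          exact ⟨w, (Finset.mem_inter.1 hw).1, Or.inr hvw⟩
        push Not at hx
        rw [status_eq_one.2 ⟨hv, hz⟩, status_eq_zero.2 ⟨hv₁', hx⟩, status_eq_one.2 ⟨hv₂', hy⟩]
        rfl
      · push Not at hx hy
        have hz : ∀ w ∈ J, ¬ (E₁ ⊔ E₂).Adj v w := by
          rintro w hw (hvw | hvw)
          · exact hx w (Finset.mem_inter.2 ⟨hw, h₁ hvw.symm⟩) hvw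
          · exact hy w (Finset.mem_inter.2 ⟨hw, h₂ hvw.symm⟩) hvw
        rw [status_eq_zero.2 ⟨hv, hz⟩, status_eq_zero.2 ⟨hv₁', hx⟩, status_eq_zero.2 ⟨hv₂', hy⟩,
          max_self]

theorem status_sup_left (h₁ : ∀ {a b}, E₁.Adj a b → a ∈ S₁) (h₂ : ∀ {a b}, E₂.Adj a b → a ∈ S₂)
    (hv₁ : v ∈ S₁) (hv₂ : v ∉ S₂) :
    status (E₁ ⊔ E₂) J v = status E₁ (J ∩ S₁) v := by
  by_cases hv : v ∈ J
  · rw [status_eq_two.2 hv, status_eq_two.2 (Finset.mem_inter.2 ⟨hv, hv₁⟩)]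
  · have hv₁' : v ∉ J ∩ S₁ := fun h => hv (Finset.mem_inter.1 h).1
    by_cases hx : ∃ w ∈ J ∩ S₁, E₁.Adj v w
    · have hz : ∃ w ∈ J, (E₁ ⊔ E₂).Adj v w := by
        obtain ⟨w, hw, hvw⟩ := hx
        exact ⟨w, (Finset.mem_inter.1 hw).1, Or.inl hvw⟩
      rw [status_eq_one.2 ⟨hv, hz⟩, status_eq_one.2 ⟨hv₁', hx⟩]
    · push Not at hx
      have hz : ∀ w ∈ J, ¬ (E₁ ⊔ E₂).Adj v w := by
        rintro w hw (hvw | hvw)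
        · exact hx w (Finset.mem_inter.2 ⟨hw, h₁ hvw.symm⟩) hvw
        · exact hv₂ (h₂ hvw)
      rw [status_eq_zero.2 ⟨hv, hz⟩, status_eq_zero.2 ⟨hv₁', hx⟩]

theorem status_sup_right (h₁ : ∀ {a b}, E₁.Adj a b → a ∈ S₁) (h₂ : ∀ {a b}, E₂.Adj a b → a ∈ S₂)
    (hv₁ : v ∉ S₁) (hv₂ : v ∈ S₂) :
    status (E₁ ⊔ E₂) J v = status E₂ (J ∩ S₂) v := by
  rw [sup_comm]
  exact status_sup_left h₂ h₁ hv₂ hv₁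

/-- `J` is an independent set of the network which dominates its internal vertices. -/
structure IsConfig {V : Type*} (E : SimpleGraph V) (S : Finset V) (s t : V) (J : Finset V) :
    Prop where
  subset : J ⊆ S
  indep : ∀ a ∈ J, ∀ b ∈ J, ¬ E.Adj a b
  dom : ∀ v ∈ S, v ≠ s → v ≠ t → status E J v ≠ 0

/-- A lower bound, in excess of `n / 3`, for the number of internal vertices in a set as in `IsConfig`,
for networks with `n % 3 = r` and terminals of status `a` and `b`. -/
def excess (r : ℕ) (a b : Fin 3) : ℕ :=
  if r = 0 then (if a ≠ 2 ∧ b ≠ 2 ∧ (a = 1 ∨ b = 1) then 1 else 0)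
  else if r = 1 then
    (if (a = 2 ∧ b = 2) ∨ (a = 2 ∧ b = 0) ∨ (a = 0 ∧ b = 2) then 0 else 1)
  else (if a = 2 ∧ b = 2 then 0 else if a = 1 ∧ b = 1 then 2 else 1)

/-- The cases in which `excess` is attained by every network. -/
def IsTight (r : ℕ) (a b : Fin 3) : Prop :=
  if r = 0 then (a = 2 ∧ b = 1) ∨ (a = 1 ∧ b = 2) ∨ (a = 0 ∧ b = 0)
  else if r = 1 then
    (a = 2 ∧ b = 2) ∨ (a = 2 ∧ b = 0) ∨ (a = 0 ∧ b = 2) ∨ (a = 1 ∧ b = 1)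
  else (a = 2 ∧ b = 2) ∨ (a = 2 ∧ b = 1) ∨ (a = 1 ∧ b = 2) ∨ (a = 1 ∧ b = 0) ∨ (a = 0 ∧ b = 1)

instance (r : ℕ) (a b : Fin 3) : Decidable (IsTight r a b) := by
  unfold IsTight; infer_instance

theorem excess_par : ∀ a₁ b₁ a₂ b₂ : Fin 3, (a₁ = 2 ↔ a₂ = 2) → (b₁ = 2 ↔ b₂ = 2) →
    excess 0 (max a₁ a₂) (max b₁ b₂) ≤ excess 0 a₁ b₁ + excess 0 a₂ b₂ := by
  decide

/-- Here `i` and `j` are the residues of the two parts, `(i + j + 1) / 3` is the carry in `n / 3`,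
and the last summand counts the middle vertex, which becomes internal. -/
theorem excess_ser : ∀ i < 3, ∀ j < 3, ∀ a c₁ c₂ b : Fin 3, (c₁ = 2 ↔ c₂ = 2) → max c₁ c₂ ≠ 0 →
    excess ((i + j + 1) % 3) a b + (i + j + 1) / 3 ≤
      excess i a c₁ + excess j c₂ b + if c₁ = 2 then 1 else 0 := by
  decide

/-- All tight pairs of residue $0$ have excess $0$. -/
theorem excess_par_of_isTight : ∀ a b : Fin 3, IsTight 0 a b →
    excess 0 a b + excess 0 a b ≤ excess 0 a b := by
  decide

/-- The tight cases are closed under series decomposition: a suitable status of the middle vertex on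
each side makes both halves tight and loses nothing in `excess_ser`. -/
theorem exists_isTight_of_ser : ∀ i < 3, ∀ j < 3, ∀ a b : Fin 3, IsTight ((i + j + 1) % 3) a b →
    ∃ c₁ c₂ : Fin 3, IsTight i a c₁ ∧ IsTight j c₂ b ∧ (c₁ = 2 ↔ c₂ = 2) ∧ max c₁ c₂ ≠ 0 ∧
      excess i a c₁ + excess j c₂ b + (if c₁ = 2 then 1 else 0) ≤
        excess ((i + j + 1) % 3) a b + (i + j + 1) / 3 := by
  intro i hi j hj
  interval_cases i <;> interval_cases j <;> decide

theorem IsConfig.inter_par {J : Finset V} (h₁ : ∀ {a b}, E₁.Adj a b → a ∈ S₁)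
    (h₂ : ∀ {a b}, E₂.Adj a b → a ∈ S₂) (hS : S₁ ∩ S₂ = {s, t}) :
    IsConfig (E₁ ⊔ E₂) (S₁ ∪ S₂) s t J ↔ J ⊆ S₁ ∪ S₂ ∧
      IsConfig E₁ S₁ s t (J ∩ S₁) ∧ IsConfig E₂ S₂ s t (J ∩ S₂) := by
  have hS' : ∀ x, x ∈ S₁ → x ∈ S₂ → x = s ∨ x = t := fun x hx hy => by
    have := Finset.mem_inter.2 ⟨hx, hy⟩
    rw [hS] at this
    simpa using this
  constructor
  · intro h
    refine ⟨h.subset, ⟨Finset.inter_subset_right, fun a ha b hb hab => ?_, fun v hv hs ht => ?_⟩,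
      ⟨Finset.inter_subset_right, fun a ha b hb hab => ?_, fun v hv hs ht => ?_⟩⟩
    · exact h.indep a (Finset.mem_inter.1 ha).1 b (Finset.mem_inter.1 hb).1 (Or.inl hab)
    · rw [← status_sup_left h₁ h₂ hv (fun hv' => by grind)]
      exact h.dom v (Finset.mem_union_left _ hv) hs ht
    · exact h.indep a (Finset.mem_inter.1 ha).1 b (Finset.mem_inter.1 hb).1 (Or.inr hab)
    · rw [← status_sup_right h₁ h₂ (fun hv' => by grind) hv]
      exact h.dom v (Finset.mem_union_right _ hv) hs ht
  · rintro ⟨hJ, c₁, c₂⟩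
    refine ⟨hJ, fun a ha b hb hab => ?_, fun v hv hs ht => ?_⟩
    · rcases hab with hab | hab
      · exact c₁.indep a (Finset.mem_inter.2 ⟨ha, h₁ hab⟩) b
          (Finset.mem_inter.2 ⟨hb, h₁ hab.symm⟩) hab
      · exact c₂.indep a (Finset.mem_inter.2 ⟨ha, h₂ hab⟩) b
          (Finset.mem_inter.2 ⟨hb, h₂ hab.symm⟩) hab
    · rcases Finset.mem_union.1 hv with hv | hv
      · rw [status_sup_left h₁ h₂ hv (fun hv' => by grind)]
        exact c₁.dom v hv hs ht
      · rw [status_sup_right h₁ h₂ (fun hv' => by grind) hv]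
        exact c₂.dom v hv hs ht

/-- The vertex `w` is a terminal of both parts but internal in the whole, so it has to be dominated
from at least one side; this is the condition on the maximum. -/
theorem IsConfig.inter_ser {w : V} {J : Finset V} (h₁ : ∀ {a b}, E₁.Adj a b → a ∈ S₁)
    (h₂ : ∀ {a b}, E₂.Adj a b → a ∈ S₂) (hs : s ∈ S₁) (ht : t ∈ S₂) (hsw : s ≠ w) (hwt : w ≠ t)
    (hS : S₁ ∩ S₂ = {w}) :
    IsConfig (E₁ ⊔ E₂) (S₁ ∪ S₂) s t J ↔ J ⊆ S₁ ∪ S₂ ∧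
      IsConfig E₁ S₁ s w (J ∩ S₁) ∧ IsConfig E₂ S₂ w t (J ∩ S₂) ∧
        max (status E₁ (J ∩ S₁) w) (status E₂ (J ∩ S₂) w) ≠ 0 := by
  have hS' : ∀ x, x ∈ S₁ → x ∈ S₂ → x = w := fun x hx hy => by
    have := Finset.mem_inter.2 ⟨hx, hy⟩
    rw [hS] at this
    simpa using this
  have hw : w ∈ S₁ ∩ S₂ := by simp [hS]
  obtain ⟨hw₁, hw₂⟩ := Finset.mem_inter.1 hw
  constructor
  · intro h
    refine ⟨h.subset, ⟨Finset.inter_subset_right, fun a ha b hb hab => ?_, fun v hv hs ht => ?_⟩,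
      ⟨Finset.inter_subset_right, fun a ha b hb hab => ?_, fun v hv hs ht => ?_⟩, ?_⟩
    · exact h.indep a (Finset.mem_inter.1 ha).1 b (Finset.mem_inter.1 hb).1 (Or.inl hab)
    · rw [← status_sup_left h₁ h₂ hv (fun hv' => by grind)]
      exact h.dom v (Finset.mem_union_left _ hv) hs (by grind)
    · exact h.indep a (Finset.mem_inter.1 ha).1 b (Finset.mem_inter.1 hb).1 (Or.inr hab)
    · rw [← status_sup_right h₁ h₂ (fun hv' => by grind) hv]
      exact h.dom v (Finset.mem_union_right _ hv) (by grind) ht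
    · rw [← status_sup h₁ h₂ hw₁ hw₂]
      exact h.dom w (Finset.mem_union_left _ hw₁) hsw.symm hwt
  · rintro ⟨hJ, c₁, c₂, hc⟩
    refine ⟨hJ, fun a ha b hb hab => ?_, fun v hv hs ht => ?_⟩
    · rcases hab with hab | hab
      · exact c₁.indep a (Finset.mem_inter.2 ⟨ha, h₁ hab⟩) b
          (Finset.mem_inter.2 ⟨hb, h₁ hab.symm⟩) hab
      · exact c₂.indep a (Finset.mem_inter.2 ⟨ha, h₂ hab⟩) b
          (Finset.mem_inter.2 ⟨hb, h₂ hab.symm⟩) hab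
    · by_cases hvw : v = w
      · rw [hvw, status_sup h₁ h₂ hw₁ hw₂]
        exact hc
      · rcases Finset.mem_union.1 hv with hv | hv
        · rw [status_sup_left h₁ h₂ hv (fun hv' => by grind)]
          exact c₁.dom v hv hs hvw
        · rw [status_sup_right h₁ h₂ (fun hv' => by grind) hv]
          exact c₂.dom v hv hvw ht

theorem card_sdiff_pair_par (hS : S₁ ∩ S₂ = {s, t}) (hJ : J ⊆ S₁ ∪ S₂) :
    (J \ {s, t}).card = ((J ∩ S₁) \ {s, t}).card + ((J ∩ S₂) \ {s, t}).card := by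
  rw [← Finset.card_union_of_disjoint]
  · congr 1
    ext x
    have := @hJ x
    grind
  · rw [Finset.disjoint_left]
    intro x hx hy
    have : x ∈ S₁ ∩ S₂ := by grind
    rw [hS] at this
    grind

theorem card_sdiff_pair_ser {w : V} (hs : s ∈ S₁) (ht : t ∈ S₂) (hsw : s ≠ w) (hwt : w ≠ t)
    (hS : S₁ ∩ S₂ = {w}) (hJ : J ⊆ S₁ ∪ S₂) :
    (J \ {s, t}).card = ((J ∩ S₁) \ {s, w}).card + ((J ∩ S₂) \ {w, t}).card +
      if w ∈ J then 1 else 0 := by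
  have hS' : ∀ x, x ∈ S₁ ∧ x ∈ S₂ ↔ x = w := fun x => by
    rw [← Finset.mem_inter, hS, Finset.mem_singleton]
  have e : (J \ {s, t}) = (((J ∩ S₁) \ {s, w}) ∪ ((J ∩ S₂) \ {w, t})) ∪ J.filter (· = w) := by
    ext x
    have := @hJ x
    have := hS' x
    have := hS' s
    have := hS' t
    have := hS' w
    grind
  have e' : (J.filter (· = w)).card = if w ∈ J then 1 else 0 := by
    rw [Finset.filter_eq' J w]; split_ifs <;> simp
  rw [e, Finset.card_union_of_disjoint, Finset.card_union_of_disjoint, e']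
  · rw [Finset.disjoint_left]
    intro x hx hy
    have := hS' x
    grind
  · rw [Finset.disjoint_left]
    intro x hx hy
    grind

theorem Network.le_card (h : Network E S s t n) : ∀ {J : Finset V}, IsConfig E S s t J →
    n / 3 + excess (n % 3) (status E J s) (status E J t) ≤ (J \ {s, t}).card := by
  induction h with
  | @edge s t h =>
    intro J hJ
    -- With no internal vertices, a terminal can have status `1` only if the other one is in `J`.
    have h0 : excess 0 (status (SimpleGraph.edge s t) J s) (status (SimpleGraph.edge s t) J t) = 0 := by
      unfold excess
      rw [if_pos rfl, if_neg]
      simp only [ne_eq, status_eq_two, status_eq_one, SimpleGraph.edge_adj]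
      grind
    simp [h0]
  | @par E₁ E₂ S₁ S₂ s t n₁ n₂ h₁ h₂ hn₁ hn₂ hS ih₁ ih₂ =>
    intro J hJ
    obtain ⟨hsub, c₁, c₂⟩ := (IsConfig.inter_par h₁.mem_of_adj h₂.mem_of_adj hS).1 hJ
    have i₁ := ih₁ c₁
    have i₂ := ih₂ c₂
    rw [card_sdiff_pair_par hS hsub, status_sup h₁.mem_of_adj h₂.mem_of_adj h₁.left_mem h₂.left_mem,
      status_sup h₁.mem_of_adj h₂.mem_of_adj h₁.right_mem h₂.right_mem]
    have := excess_par (status E₁ (J ∩ S₁) s) (status E₁ (J ∩ S₁) t) (status E₂ (J ∩ S₂) s)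
      (status E₂ (J ∩ S₂) t) (by simp [status_eq_two, h₁.left_mem, h₂.left_mem])
      (by simp [status_eq_two, h₁.right_mem, h₂.right_mem])
    rw [hn₁] at i₁
    rw [hn₂] at i₂
    have e : (n₁ + n₂) % 3 = 0 := by omega
    rw [e]
    omega
  | @ser E₁ E₂ S₁ S₂ s w t n₁ n₂ h₁ h₂ hS ih₁ ih₂ =>
    intro J hJ
    have hs : s ∉ S₂ := fun hs => h₁.ne (by simpa [hS] using Finset.mem_inter.2 ⟨h₁.left_mem, hs⟩)
    have ht : t ∉ S₁ := fun ht =>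
      h₂.ne (by simpa [hS, eq_comm] using Finset.mem_inter.2 ⟨ht, h₂.right_mem⟩)
    obtain ⟨hsub, c₁, c₂, hc⟩ := (IsConfig.inter_ser h₁.mem_of_adj h₂.mem_of_adj h₁.left_mem
      h₂.right_mem h₁.ne h₂.ne hS).1 hJ
    have i₁ := ih₁ c₁
    have i₂ := ih₂ c₂
    rw [card_sdiff_pair_ser h₁.left_mem h₂.right_mem h₁.ne h₂.ne hS hsub,
      status_sup_left h₁.mem_of_adj h₂.mem_of_adj h₁.left_mem hs,
      status_sup_right h₁.mem_of_adj h₂.mem_of_adj ht h₂.right_mem]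
    have := excess_ser (n₁ % 3) (Nat.mod_lt _ (by norm_num)) (n₂ % 3) (Nat.mod_lt _ (by norm_num))
      (status E₁ (J ∩ S₁) s) (status E₁ (J ∩ S₁) w) (status E₂ (J ∩ S₂) w) (status E₂ (J ∩ S₂) t)
      (by simp [status_eq_two, h₁.right_mem, h₂.left_mem]) hc
    simp only [status_eq_two, Finset.mem_inter, h₁.right_mem, and_true] at this
    have e : (n₁ + n₂ + 1) % 3 = (n₁ % 3 + n₂ % 3 + 1) % 3 := by omega
    rw [e]
    omega

theorem Network.exists_isConfig (h : Network E S s t n) : ∀ {a b : Fin 3}, IsTight (n % 3) a b →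
    ∃ J : Finset V, IsConfig E S s t J ∧ status E J s = a ∧ status E J t = b ∧
      (J \ {s, t}).card ≤ n / 3 + excess (n % 3) a b := by
  induction h with
  | @edge s t h =>
    intro a b hab
    have hab' : (a = 2 ∧ b = 1) ∨ (a = 1 ∧ b = 2) ∨ (a = 0 ∧ b = 0) := by simpa [IsTight] using hab
    have hd : ∀ J : Finset V, ∀ v ∈ ({s, t} : Finset V), v ≠ s → v ≠ t →
      status (SimpleGraph.edge s t) J v ≠ 0 := by grind
    rcases hab' with ⟨rfl, rfl⟩ | ⟨rfl, rfl⟩ | ⟨rfl, rfl⟩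
    · refine ⟨{s}, ⟨by simp, by simp, hd _⟩, ?_, ?_, by
        rw [Finset.sdiff_eq_empty_iff_subset.2 (by simp)]; simp⟩
      · simp [status_eq_two]
      · simp [status_eq_one, SimpleGraph.edge_adj, h.symm]
    · refine ⟨{t}, ⟨by simp, by simp, hd _⟩, ?_, ?_, by
        rw [Finset.sdiff_eq_empty_iff_subset.2 (by simp)]; simp⟩
      · simp [status_eq_one, SimpleGraph.edge_adj, h]
      · simp [status_eq_two]
    · exact ⟨∅, ⟨by simp, by simp, hd _⟩, by simp [status_eq_zero], by simp [status_eq_zero],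
        by simp⟩
  | @par E₁ E₂ S₁ S₂ s t n₁ n₂ h₁ h₂ hn₁ hn₂ hS ih₁ ih₂ =>
    intro a b hab
    have e : (n₁ + n₂) % 3 = 0 := by omega
    rw [e] at hab ⊢
    obtain ⟨J₁, c₁, s₁, t₁, k₁⟩ := ih₁ (a := a) (b := b) (by rwa [hn₁])
    obtain ⟨J₂, c₂, s₂, t₂, k₂⟩ := ih₂ (a := a) (b := b) (by rwa [hn₂])
    -- Equal statuses at the terminals make `J₁` and `J₂` agree on the overlap, so their union
    -- restricts to each of them.
    have hag : ∀ x ∈ S₁, x ∈ S₂ → (x ∈ J₁ ↔ x ∈ J₂) := by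
      intro x hx hy
      have : x ∈ S₁ ∩ S₂ := Finset.mem_inter.2 ⟨hx, hy⟩
      rw [hS] at this
      simp only [Finset.mem_insert, Finset.mem_singleton] at this
      rcases this with rfl | rfl
      · rw [← status_eq_two (E := E₁), s₁, ← s₂, status_eq_two]
      · rw [← status_eq_two (E := E₁), t₁, ← t₂, status_eq_two]
    have e₁ : (J₁ ∪ J₂) ∩ S₁ = J₁ := by
      have := c₁.subset; have := c₂.subset; grind
    have e₂ : (J₁ ∪ J₂) ∩ S₂ = J₂ := by
      have := c₁.subset; have := c₂.subset; grind
    have hsub : J₁ ∪ J₂ ⊆ S₁ ∪ S₂ := Finset.union_subset_union c₁.subset c₂.subset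
    refine ⟨J₁ ∪ J₂, (IsConfig.inter_par h₁.mem_of_adj h₂.mem_of_adj hS).2 ⟨hsub, ?_, ?_⟩, ?_, ?_, ?_⟩
    · rwa [e₁]
    · rwa [e₂]
    · rw [status_sup h₁.mem_of_adj h₂.mem_of_adj h₁.left_mem h₂.left_mem, e₁, e₂, s₁, s₂, max_self]
    · rw [status_sup h₁.mem_of_adj h₂.mem_of_adj h₁.right_mem h₂.right_mem, e₁, e₂, t₁, t₂,
        max_self]
    · rw [card_sdiff_pair_par hS hsub, e₁, e₂]
      have := excess_par_of_isTight a b hab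
      rw [hn₁] at k₁
      rw [hn₂] at k₂
      omega
  | @ser E₁ E₂ S₁ S₂ s w t n₁ n₂ h₁ h₂ hS ih₁ ih₂ =>
    intro a b hab
    have hs : s ∉ S₂ := fun hs => h₁.ne (by simpa [hS] using Finset.mem_inter.2 ⟨h₁.left_mem, hs⟩)
    have ht : t ∉ S₁ := fun ht =>
      h₂.ne (by simpa [hS, eq_comm] using Finset.mem_inter.2 ⟨ht, h₂.right_mem⟩)
    have e : (n₁ + n₂ + 1) % 3 = (n₁ % 3 + n₂ % 3 + 1) % 3 := by omega
    rw [e] at hab ⊢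
    obtain ⟨c, d, hac, hdb, hcd, hmax, hle⟩ := exists_isTight_of_ser (n₁ % 3)
      (Nat.mod_lt _ (by norm_num)) (n₂ % 3) (Nat.mod_lt _ (by norm_num)) a b hab
    obtain ⟨J₁, c₁, s₁, t₁, k₁⟩ := ih₁ hac
    obtain ⟨J₂, c₂, s₂, t₂, k₂⟩ := ih₂ hdb
    have hag : ∀ x ∈ S₁, x ∈ S₂ → (x ∈ J₁ ↔ x ∈ J₂) := by
      intro x hx hy
      have : x ∈ S₁ ∩ S₂ := Finset.mem_inter.2 ⟨hx, hy⟩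
      rw [hS, Finset.mem_singleton] at this
      subst this
      rw [← status_eq_two (E := E₁), t₁, hcd, ← s₂, status_eq_two]
    have e₁ : (J₁ ∪ J₂) ∩ S₁ = J₁ := by
      have := c₁.subset; have := c₂.subset; grind
    have e₂ : (J₁ ∪ J₂) ∩ S₂ = J₂ := by
      have := c₁.subset; have := c₂.subset; grind
    have hsub : J₁ ∪ J₂ ⊆ S₁ ∪ S₂ := Finset.union_subset_union c₁.subset c₂.subset
    have hw : w ∈ J₁ ∪ J₂ ↔ c = 2 := by
      rw [← t₁, status_eq_two, Finset.mem_union, ← hag w h₁.right_mem h₂.left_mem, or_self]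
    refine ⟨J₁ ∪ J₂, (IsConfig.inter_ser h₁.mem_of_adj h₂.mem_of_adj h₁.left_mem h₂.right_mem h₁.ne
      h₂.ne hS).2 ⟨hsub, ?_, ?_, ?_⟩, ?_, ?_, ?_⟩
    · rwa [e₁]
    · rwa [e₂]
    · rwa [e₁, e₂, t₁, s₂]
    · rw [status_sup_left h₁.mem_of_adj h₂.mem_of_adj h₁.left_mem hs, e₁, s₁]
    · rw [status_sup_right h₁.mem_of_adj h₂.mem_of_adj ht h₂.right_mem, e₂, t₂]
    · rw [card_sdiff_pair_ser h₁.left_mem h₂.right_mem h₁.ne h₂.ne hS hsub, e₁, e₂]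
      simp only [hw]
      omega

end Network

/-! ### First and last occurrences in lists -/

section ListSplit

variable {α : Type*} {p : α → Prop} {l : List α}

theorem exists_eq_append_cons_of_first (h : ∃ x ∈ l, p x) :
    ∃ l₁ c l₂, l = l₁ ++ c :: l₂ ∧ p c ∧ ∀ y ∈ l₁, ¬ p y := by
  induction l with
  | nil => simp at h
  | cons a l ih =>
    by_cases ha : p a
    · exact ⟨[], a, l, rfl, ha, by simp⟩
    · obtain ⟨l₁, c, l₂, rfl, hc, hl⟩ := ih (by grind)
      exact ⟨a :: l₁, c, l₂, rfl, hc, by grind⟩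

theorem exists_eq_append_cons_of_last (h : ∃ x ∈ l, p x) :
    ∃ l₁ c l₂, l = l₁ ++ c :: l₂ ∧ p c ∧ ∀ y ∈ l₂, ¬ p y := by
  obtain ⟨l₁, c, l₂, hl, hc, hn⟩ := exists_eq_append_cons_of_first (l := l.reverse) (p := p)
    (by simpa using h)
  refine ⟨l₂.reverse, c, l₁.reverse, ?_, hc, by simpa using hn⟩
  rw [← List.reverse_reverse l, hl]
  simp

end ListSplit

/-! ### Decomposition of two-terminal graphs -/

/-- The graph `E` with all edges not contained in `T` removed. -/
def restrict {V : Type*} (E : SimpleGraph V) (T : Set V) : SimpleGraph V where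
  Adj a b := E.Adj a b ∧ a ∈ T ∧ b ∈ T
  symm := ⟨fun _ _ h => ⟨h.1.symm, h.2.2, h.2.1⟩⟩
  loopless := ⟨fun _ h => h.1.ne rfl⟩

section Restrict

variable {V : Type*} {E : SimpleGraph V} {T : Set V} {u v : V}

theorem restrict_le : restrict E T ≤ E := fun _ _ h => h.1

theorem mem_of_reachable_restrict (h : (restrict E T).Reachable u v) (hu : u ∈ T) : v ∈ T := by
  by_cases huv : u = v
  · exact huv ▸ hu
  · obtain ⟨l, hl⟩ := exists_isLink_of_reachable h huv
    exact hl.mem_of_adj (S := T) (fun a b hab => hab.2.1) (by simp)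

theorem exists_isLink_of_forall_exists_adj {S : Finset V} (hE : ∀ {a b}, E.Adj a b → a ∈ S)
    (hu : u ∈ S) (huv : u ≠ v)
    (h : ∀ C ⊆ S, u ∈ C → v ∉ C → ∃ a ∈ C, ∃ b, b ∉ C ∧ E.Adj a b) : ∃ l, IsLink E u l v := by
  classical
  by_contra hn
  have hr : ¬ E.Reachable u v := fun h => hn (exists_isLink_of_reachable h huv)
  obtain ⟨a, ha, b, hb, hab⟩ := h (S.filter fun x => E.Reachable u x) (Finset.filter_subset _ _)
    (by simp [hu]) (by simp [hr])
  simp only [Finset.mem_filter] at ha hb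
  exact hb ⟨hE hab.symm, ha.2.trans hab.reachable⟩

end Restrict

theorem IsLink.of_infix {V : Type*} {E : SimpleGraph V} {u v x y : V} {l R : List V}
    (h : IsLink E u l v) (hx : x :: (R ++ [y]) <:+: u :: (l ++ [v])) : IsLink E x R y :=
  ⟨h.1.sublist hx.sublist, h.2.infix hx⟩

/-- A graph on `S` with terminals `s` and `t`, whose union with the edge `st` is `2`-connected, such
that the numbers of internal vertices of the paths from `s` to `t` are congruent to `r` modulo `3`
and the lengths of the cycles are congruent to `2` modulo `3`. -/
structure IsTwoTerminal {V : Type*} (E : SimpleGraph V) (S : Finset V) (s t : V) (r : ℕ) :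
    Prop where
  ne : s ≠ t
  left_mem : s ∈ S
  right_mem : t ∈ S
  mem_of_adj : ∀ {a b}, E.Adj a b → a ∈ S
  exists_adj : ∀ C ⊆ S, C.Nonempty → s ∉ C → t ∉ C → ∀ x, ∃ a ∈ C, ∃ b, b ∉ C ∧ b ≠ x ∧ E.Adj a b
  exists_adj' : ∀ C ⊆ S, s ∈ C → t ∉ C → ∃ a ∈ C, ∃ b, b ∉ C ∧ E.Adj a b
  link_mod : ∀ l, IsLink E s l t → l.length % 3 = r % 3
  cycle_mod : ∀ u v A B, IsLink E u A v → IsLink E u B v → (∀ x ∈ A, x ∉ B) → A ≠ [] →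
    (A.length + B.length) % 3 = 0

section TwoTerminal

variable {V : Type*} {E : SimpleGraph V} {S : Finset V} {s t : V} {r : ℕ}

theorem IsTwoTerminal.exists_isLink (h : IsTwoTerminal E S s t r) : ∃ l, IsLink E s l t :=
  exists_isLink_of_forall_exists_adj h.mem_of_adj h.left_mem h.ne h.exists_adj'

theorem IsTwoTerminal.of_parallel [DecidableEq V] (h : IsTwoTerminal E S s t r) {C : Finset V}
    {E' : SimpleGraph V} (hC : C ⊆ S) (hne : C.Nonempty) (hs : s ∉ C) (ht : t ∉ C)
    (hle : E' ≤ E) (hE' : ∀ {a b}, E'.Adj a b → a ∈ C ∪ {s, t})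
    (hadj : ∀ a ∈ C, ∀ b, E.Adj a b → E'.Adj a b) : IsTwoTerminal E' (C ∪ {s, t}) s t r where
  ne := h.ne
  left_mem := by simp
  right_mem := by simp
  mem_of_adj := hE'
  exists_adj D hD hD' hsD htD x := by
    have hDC : D ⊆ C := by grind
    obtain ⟨a, ha, b, hb, hbx, hab⟩ := h.exists_adj D (hDC.trans hC) hD' hsD htD x
    exact ⟨a, ha, b, hb, hbx, hadj a (hDC ha) b hab⟩
  exists_adj' D hD hsD htD := by
    by_cases hDC : (D ∩ C).Nonempty
    -- Excluding `s` leaves `b = t` or `b ∈ C \ D`, so `b` is outside `D`.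
    · obtain ⟨a, ha, b, hb, hbx, hab⟩ := h.exists_adj (D ∩ C)
        (Finset.inter_subset_right.trans hC) hDC (by simp [hs]) (by simp [ht]) s
      have hab' := hadj a (Finset.mem_inter.1 ha).2 b hab
      have hbS := hE' hab'.symm
      exact ⟨a, (Finset.mem_inter.1 ha).1, b, by grind, hab'⟩
    · obtain ⟨a, ha, b, hb, hbx, hab⟩ := h.exists_adj C hC hne hs ht t
      have hab' := hadj a ha b hab
      have hbS := hE' hab'.symm
      have hbs : b = s := by grind
      refine ⟨b, hbs ▸ hsD, a, fun haD => hDC ⟨a, Finset.mem_inter.2 ⟨haD, ha⟩⟩, hab'.symm⟩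
  link_mod l hl := h.link_mod l (hl.mono hle)
  cycle_mod u v A B hA hB := h.cycle_mod u v A B (hA.mono hle) (hB.mono hle)

/-- Splitting a two-terminal graph at a vertex `w` that separates its terminals. -/
theorem IsTwoTerminal.split [DecidableEq V] (h : IsTwoTerminal E S s t r) {R : Finset V} {w : V} (hR : R ⊆ S)
    (hw : w ∈ S) (hwt : w ≠ t) (hsR : s ∈ R) (htR : t ∉ R) (hwR : w ∉ R)
    (hcl : ∀ a ∈ R, ∀ b, E.Adj a b → b ≠ w → b ∈ R) :
    ∃ r₁ r₂, IsTwoTerminal (restrict E ↑(insert w R)) (insert w R) s w r₁ ∧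
      IsTwoTerminal (restrict E ↑(S \ R)) (S \ R) w t r₂ ∧ (r₁ + r₂ + 1) % 3 = r % 3 := by
  have hsw : s ≠ w := fun e => hwR (e ▸ hsR)
  have m₁ : ∀ {a b}, (restrict E ↑(insert w R)).Adj a b → a ∈ insert w R :=
    fun hab => Finset.mem_coe.1 hab.2.1
  have m₂ : ∀ {a b}, (restrict E ↑(S \ R)).Adj a b → a ∈ S \ R :=
    fun hab => Finset.mem_coe.1 hab.2.1
  have a₁ : ∀ a ∈ R, ∀ b, E.Adj a b → (restrict E ↑(insert w R)).Adj a b := by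
    intro a ha b hab
    refine ⟨hab, by simp [ha], ?_⟩
    have := hcl a ha b hab
    simp only [Finset.mem_coe, Finset.mem_insert]
    grind
  have a₂ : ∀ a ∉ R, a ≠ w → ∀ b, E.Adj a b → (restrict E ↑(S \ R)).Adj a b := by
    intro a ha haw b hab
    refine ⟨hab, Finset.mem_coe.2 (Finset.mem_sdiff.2 ⟨h.mem_of_adj hab, ha⟩),
      Finset.mem_coe.2 (Finset.mem_sdiff.2 ⟨h.mem_of_adj hab.symm, fun hb => ?_⟩)⟩
    exact ha (hcl b hb a hab.symm haw)
  have c₁ : ∀ C ⊆ insert w R, s ∈ C → w ∉ C →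
      ∃ a ∈ C, ∃ b, b ∉ C ∧ (restrict E ↑(insert w R)).Adj a b := by
    intro C hC hs hwC
    have hCR : C ⊆ R := by grind
    obtain ⟨a, ha, b, hb, hab⟩ := h.exists_adj' C (hCR.trans hR) hs (fun ht => htR (hCR ht))
    exact ⟨a, ha, b, hb, a₁ a (hCR ha) b hab⟩
  have c₂ : ∀ C ⊆ S \ R, w ∈ C → t ∉ C → ∃ a ∈ C, ∃ b, b ∉ C ∧ (restrict E ↑(S \ R)).Adj a b := by
    intro C hC hwC ht
    -- An edge leaving `C ∪ R` cannot start in `R`, whose only possible outer neighbor `w` lies in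
    -- `C`.
    obtain ⟨a, ha, b, hb, hab⟩ := h.exists_adj' (C ∪ R)
      (Finset.union_subset (hC.trans Finset.sdiff_subset) hR) (by simp [hsR]) (by simp [htR, ht])
    have haR : a ∉ R := by
      intro haR
      have := hcl a haR b hab
      grind
    have haC : a ∈ C := by grind
    refine ⟨a, haC, b, by grind, hab, Finset.mem_coe.2 (hC haC), ?_⟩
    have := h.mem_of_adj hab.symm
    simp only [Finset.mem_coe]
    grind
  obtain ⟨l₁, hl₁⟩ := exists_isLink_of_forall_exists_adj m₁ (by simp [hsR]) hsw c₁
  obtain ⟨l₂, hl₂⟩ := exists_isLink_of_forall_exists_adj m₂ (by simp [hw, hwR]) hwt c₂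
  have key : ∀ l l', IsLink (restrict E ↑(insert w R)) s l w → IsLink (restrict E ↑(S \ R)) w l' t →
      (l.length + l'.length + 1) % 3 = r % 3 := by
    intro l l' hl hl'
    have := h.link_mod _ ((hl.mono restrict_le).append (hl'.mono restrict_le) (by
      intro x hx hx'
      have i₁ := hl.mem_of_adj (S := ↑(insert w R)) (fun a b hab => m₁ hab) (x := x) (by grind)
      have i₂ := hl'.mem_of_adj (S := ↑(S \ R)) (fun a b hab => m₂ hab) (x := x) (by grind)
      rw [Finset.mem_coe] at i₁ i₂
      have := hl.1
      grind))
    rw [← this]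
    simp only [List.length_append, List.length_cons]
    omega
  -- By `key`, pairing any link of one side with the fixed link of the other determines its residue.
  refine ⟨l₁.length, l₂.length, ⟨hsw, by simp [hsR], by simp, m₁, ?_, c₁, fun l hl => ?_, ?_⟩,
    ⟨hwt, by simp [hw, hwR], by simp [h.right_mem, htR], m₂, ?_, c₂, fun l hl => ?_, ?_⟩,
    key l₁ l₂ hl₁ hl₂⟩
  · intro C hC hne hs hwC x
    have hCR : C ⊆ R := by grind
    obtain ⟨a, ha, b, hb, hbx, hab⟩ := h.exists_adj C (hCR.trans hR) hne hs
      (fun ht => htR (hCR ht)) x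
    exact ⟨a, ha, b, hb, hbx, a₁ a (hCR ha) b hab⟩
  · have := key l l₂ hl hl₂
    have := key l₁ l₂ hl₁ hl₂
    omega
  · exact fun u v A B hA hB => h.cycle_mod u v A B (hA.mono restrict_le) (hB.mono restrict_le)
  · intro C hC hne hwC ht x
    obtain ⟨a, ha, b, hb, hbx, hab⟩ := h.exists_adj C (hC.trans Finset.sdiff_subset) hne
      (by grind) ht x
    exact ⟨a, ha, b, hb, hbx, a₂ a (by grind) (by grind) b hab⟩
  · have := key l₁ l hl₁ hl
    have := key l₁ l₂ hl₁ hl₂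
    omega
  · exact fun u v A B hA hB => h.cycle_mod u v A B (hA.mono restrict_le) (hB.mono restrict_le)

/-- Otherwise the component of `y` after removing `x` avoids both terminals and has no outer
neighbor but `x`, against `exists_adj`. -/
theorem IsTwoTerminal.reachable_restrict (h : IsTwoTerminal E S s t r) {x y : V} (hxy : y ≠ x)
    (hy : y ∈ S) (hx : (restrict E {x}ᶜ).Reachable s t) : (restrict E {x}ᶜ).Reachable s y := by
  classical
  by_contra hs
  have ht : ¬ (restrict E {x}ᶜ).Reachable y t := fun ht => hs (hx.trans ht.symm)
  obtain ⟨a, ha, b, hb, hbx, hab⟩ := h.exists_adj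
    (S.filter fun z => (restrict E {x}ᶜ).Reachable y z) (Finset.filter_subset _ _)
    ⟨y, by simp [hy]⟩ (fun hr => hs (Finset.mem_filter.1 hr).2.symm) (by simp [ht]) x
  simp only [Finset.mem_filter] at ha hb
  have hax : a ∈ ({x}ᶜ : Set V) := mem_of_reachable_restrict ha.2 (by simpa using hxy)
  refine hb ⟨h.mem_of_adj hab.symm, ha.2.trans (SimpleGraph.Adj.reachable ⟨hab, hax, ?_⟩)⟩
  simpa using hbx

/-- Rerouting two internally disjoint paths from `s` to `x`, along a path that avoids `x` and
leaves them at a vertex of the first one, into two internally disjoint paths to a neighbor of `x`. -/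
theorem IsLink.reroute {x y c : V} {A B R : List V} (hA : IsLink E s A x) (hB : IsLink E s B x)
    (hAB : ∀ z ∈ A, z ∉ B) (hxy : E.Adj x y) (hyA : y ∉ A) (hyB : y ∉ B) (hys : y ≠ s)
    (hc : c ∈ A) (hR : IsLink E c R y) (hRs : ∀ z ∈ R, z ≠ s ∧ z ≠ x ∧ z ∉ A ∧ z ∉ B) :
    ∃ A' B', IsLink E s A' y ∧ IsLink E s B' y ∧ ∀ z ∈ A', z ∉ B' := by
  obtain ⟨A₁, A₂, rfl⟩ := List.append_of_mem hc
  obtain ⟨h₁, h₂, hd⟩ := hA.split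
  have n₁ := hA.1
  have n₂ := hB.1
  refine ⟨_, _, h₁.append hR ?_, hB.append (isLink_nil_iff.2 hxy) ?_, ?_⟩
  · grind
  · grind
  · have := hxy.ne
    grind

/-- Menger's theorem for two paths: the set of vertices joined to `s` by two internally disjoint
paths, together with `s`, has no boundary edge. The pair may be degenerate, with both lists empty.
-/
theorem IsTwoTerminal.exists_disjoint_isLink (h : IsTwoTerminal E S s t r)
    (hcut : ∀ w, w ≠ s → w ≠ t → (restrict E {w}ᶜ).Reachable s t) :
    ∃ A B, IsLink E s A t ∧ IsLink E s B t ∧ ∀ x ∈ A, x ∉ B := by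
  classical
  by_contra hcon
  obtain ⟨x, hx, y, hy, hxy⟩ := h.exists_adj' (S.filter fun x => x = s ∨
    ∃ A B, IsLink E s A x ∧ IsLink E s B x ∧ ∀ z ∈ A, z ∉ B) (Finset.filter_subset _ _)
    (by simp [h.left_mem]) (by
      rw [Finset.mem_filter]
      rintro ⟨-, h' | h'⟩
      · exact h.ne h'.symm
      · exact hcon h')
  have hyS := h.mem_of_adj hxy.symm
  have hxt : x ≠ t := by
    rintro rfl
    exact ((Finset.mem_filter.1 hx).2.resolve_left h.ne.symm |> hcon)
  refine hy (Finset.mem_filter.2 ⟨hyS, or_iff_not_imp_left.2 fun hys => ?_⟩)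
  by_cases hxs : x = s
  · subst hxs
    exact ⟨[], [], isLink_nil_iff.2 hxy, isLink_nil_iff.2 hxy, by simp⟩
  obtain ⟨A, B, hA, hB, hAB⟩ := (Finset.mem_filter.1 hx).2.resolve_left hxs
  have n₁ := hA.1
  have n₂ := hB.1
  have hne := hxy.ne
  by_cases hyA : y ∈ A
  · obtain ⟨A₁, A₂, rfl⟩ := List.append_of_mem hyA
    obtain ⟨h₁, h₂, hd⟩ := hA.split
    refine ⟨_, _, h₁, hB.append h₂.reverse ?_, ?_⟩ <;> grind
  by_cases hyB : y ∈ B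
  · obtain ⟨B₁, B₂, rfl⟩ := List.append_of_mem hyB
    obtain ⟨h₁, h₂, hd⟩ := hB.split
    refine ⟨_, _, h₁, hA.append h₂.reverse ?_, ?_⟩ <;> grind
  obtain ⟨R, hR⟩ := exists_isLink_of_reachable
    (h.reachable_restrict hxy.ne.symm hyS (hcut x hxs hxt)) (Ne.symm hys)
  have hxR : ∀ z ∈ R, z ≠ x := fun z hz =>
    hR.mem_of_adj (S := {x}ᶜ) (fun a b hab => hab.2.1) (x := z) (by simp [hz])
  replace hR := hR.mono restrict_le
  have n₃ := hR.1
  -- From its last vertex `c` on the two paths onwards, the path avoiding `x` reaches `y` without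
  -- meeting them again.
  obtain ⟨R₁, c, R₂, hsplit, hc, hlast⟩ := exists_eq_append_cons_of_last (l := s :: R)
    (p := fun z => z = s ∨ z ∈ A ∨ z ∈ B) ⟨s, by simp, Or.inl rfl⟩
  rcases R₁ with _ | ⟨a, R₁⟩
  · obtain ⟨rfl, rfl⟩ : s = c ∧ R = R₂ := by simpa using hsplit
    refine ⟨_, _, hR, hA.append (isLink_nil_iff.2 hxy) ?_, ?_⟩ <;> grind
  · obtain ⟨rfl, rfl⟩ : s = a ∧ R = R₁ ++ c :: R₂ := by simpa using hsplit
    obtain ⟨-, hR₂, -⟩ := hR.split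
    have hcs : c ≠ s := by grind
    have hRs : ∀ z ∈ R₂, z ≠ s ∧ z ≠ x ∧ z ∉ A ∧ z ∉ B := by grind
    rcases hc.resolve_left hcs with hc | hc
    · exact hA.reroute hB hAB hxy hyA hyB hys hc hR₂ hRs
    · exact hB.reroute hA (fun z hz hz' => hAB z hz' hz) hxy hyB hyA hys hc hR₂ (by grind)

/-- Two disjoint paths from `s` to `t` and a path crossing between their interiors form a subdivided
$K_4$ minus the edge `st`, whose paths and cycles have incompatible lengths. -/
theorem IsTwoTerminal.false_of_connected [DecidableEq V] (h : IsTwoTerminal E S s t r) (hst : ¬ E.Adj s t)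
    (hcut : ∀ w, w ≠ s → w ≠ t → (restrict E {w}ᶜ).Reachable s t)
    (hconn : ∀ x ∈ S, ∀ y ∈ S, x ≠ s → x ≠ t → y ≠ s → y ≠ t →
      (restrict E {s, t}ᶜ).Reachable x y) : False := by
  obtain ⟨A, B, hA, hB, hAB⟩ := h.exists_disjoint_isLink hcut
  have n₁ := hA.1
  have n₂ := hB.1
  obtain ⟨a, haA⟩ : ∃ a, a ∈ A := by
    rcases A with _ | ⟨a, A⟩
    · exact absurd (isLink_nil_iff.1 hA) hst
    · exact ⟨a, by simp⟩
  obtain ⟨b, hbB⟩ : ∃ b, b ∈ B := by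
    rcases B with _ | ⟨a, A⟩
    · exact absurd (isLink_nil_iff.1 hB) hst
    · exact ⟨a, by simp⟩
  have hab : a ≠ b := fun e => hAB a haA (e ▸ hbB)
  have haS : a ∈ S := hA.mem_of_adj (S := ↑S) (fun a b hab => h.mem_of_adj hab) (by simp [haA])
  have hbS : b ∈ S := hB.mem_of_adj (S := ↑S) (fun a b hab => h.mem_of_adj hab) (by simp [hbB])
  obtain ⟨M, hM⟩ := exists_isLink_of_reachable (hconn a haS b hbS (by grind) (by grind) (by grind)
    (by grind)) hab
  have hMst : ∀ z ∈ a :: (M ++ [b]), z ≠ s ∧ z ≠ t := fun z hz => by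
    simpa using hM.mem_of_adj (S := {s, t}ᶜ) (fun a b hab => hab.2.1) hz
  replace hM := hM.mono restrict_le
  -- The last vertex on `A` and the first later one on `B` bound a crossing `R` with interior off
  -- both paths.
  obtain ⟨M₁, x, M₂, hx, hxA, hM₂⟩ := exists_eq_append_cons_of_last (l := a :: (M ++ [b]))
    (p := (· ∈ A)) ⟨a, by simp, haA⟩
  have hbM₂ : b ∈ M₂ := by
    have e : (a :: (M ++ [b])).getLast? = some b := by
      rw [← List.cons_append, List.getLast?_concat]
    rw [hx] at e
    rcases M₂.eq_nil_or_concat with rfl | ⟨M₂, z, rfl⟩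
    · simp at e
      grind
    · have : (M₁ ++ x :: (M₂.concat z)) = (M₁ ++ x :: M₂) ++ [z] := by simp
      rw [this, List.getLast?_concat] at e
      simp at e
      simp [e]
  obtain ⟨R, y, M₃, rfl, hyB, hR⟩ := exists_eq_append_cons_of_first (l := M₂)
    (p := (· ∈ B)) ⟨b, hbM₂, hbB⟩
  have hRst : ∀ z ∈ R, z ≠ s ∧ z ≠ t ∧ z ∉ A ∧ z ∉ B := by
    intro z hz
    have := hMst z (by rw [hx]; simp [hz])
    have := hM₂ z (by simp [hz])
    have := hR z hz
    grind
  have hxy : IsLink E x R y := hM.of_infix ⟨M₁, M₃, by rw [hx]; simp⟩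
  have n₃ := hxy.1
  obtain ⟨A₁, A₂, rfl⟩ := List.append_of_mem hxA
  obtain ⟨B₁, B₂, rfl⟩ := List.append_of_mem hyB
  obtain ⟨hA₁, hA₂, -⟩ := hA.split
  obtain ⟨hB₁, hB₂, -⟩ := hB.split
  have hxt : IsLink E x (R ++ y :: B₂) t := hxy.append hB₂ (by grind)
  have hsx : IsLink E s (B₁ ++ y :: R.reverse) x := hB₁.append hxy.reverse (by grind)
  have i₁ := h.link_mod _ hA
  have i₂ := h.link_mod _ hB
  have i₃ := h.link_mod _ (hA₁.append hxt (by grind))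
  have i₄ := h.link_mod _ (hsx.append hA₂ (by grind))
  have i₅ := h.cycle_mod _ _ _ _ hsx hA₁ (by
    intro z hz hz'
    have hzA : z ∈ A₁ ++ x :: A₂ := by simp [hz']
    simp only [List.mem_append, List.mem_cons, List.mem_reverse] at hz
    rcases hz with hz | rfl | hz
    · exact hAB z hzA (by simp [hz])
    · exact hAB z hzA hyB
    · exact (hRst z hz).2.2.1 hzA) (by simp)
  have i₆ := h.cycle_mod _ _ _ _ hxt hA₂ (by
    intro z hz hz'
    have hzA : z ∈ A₁ ++ x :: A₂ := by simp [hz']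
    simp only [List.mem_append, List.mem_cons] at hz
    rcases hz with hz | rfl | hz
    · exact (hRst z hz).2.2.1 hzA
    · exact hAB z hzA hyB
    · exact hAB z hzA (by simp [hz])) (by simp)
  have i₇ := h.cycle_mod _ _ _ _ hA hB hAB (by simp)
  simp only [List.length_append, List.length_cons, List.length_reverse] at i₁ i₂ i₃ i₄ i₅ i₆ i₇
  -- `i₁`, `i₂` and `i₇` make the common residue $0$; then `i₃ + i₄` gives $|R|\equiv 2$, while `i₅
  -- + i₆` gives $|R|\equiv 0$.
  omega

open Classical in
theorem IsTwoTerminal.exists_network [DecidableEq V] (h : IsTwoTerminal E S s t r) :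
    ∃ n, Network E S s t n ∧ n % 3 = r % 3 := by
  -- The factor `2` lets a part lose vertices yet gain an edge between its new terminals; the second
  -- summand pays for deleting the edge `st`.
  induction hk : 2 * S.card + (if E.Adj s t then 1 else 0) using Nat.strong_induction_on
    generalizing E S s t r with
  | _ k ih =>
    subst hk
    have hs := h.left_mem
    have ht := h.right_mem
    have hst := h.ne
    by_cases hadj : E.Adj s t
    · have hr : 0 % 3 = r % 3 := h.link_mod [] (isLink_nil_iff.2 hadj)
      by_cases hS : (S \ {s, t}).Nonempty
      · have hSe : S \ {s, t} ∪ {s, t} = S := Finset.sdiff_union_of_subset (by grind)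
        have h' := h.of_parallel (C := S \ {s, t}) (E' := E.deleteEdges {s(s, t)})
          Finset.sdiff_subset hS (by simp) (by simp) (SimpleGraph.deleteEdges_le _)
          (fun {a b} hab => by
            rw [hSe]
            exact h.mem_of_adj (SimpleGraph.deleteEdges_le _ hab))
          (fun a ha b hab => by
            rw [SimpleGraph.deleteEdges_adj]
            refine ⟨hab, ?_⟩
            simp only [Finset.mem_sdiff, Finset.mem_insert, Finset.mem_singleton] at ha
            simp only [Set.mem_singleton_iff, Sym2.eq_iff]
            grind)
        rw [hSe] at h'
        obtain ⟨n, hn, hnr⟩ := ih _ (by simp [hadj]) h' rfl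
        refine ⟨0 + n, ?_, by omega⟩
        have := (Network.edge hst).par hn rfl (by omega) (by grind)
        have e₁ : SimpleGraph.edge s t ⊔ E.deleteEdges {s(s, t)} = E := by
          ext a b
          simp only [SimpleGraph.sup_adj, SimpleGraph.edge_adj, SimpleGraph.deleteEdges_adj,
            Set.mem_singleton_iff, Sym2.eq_iff]
          have := hadj.symm
          grind
        have e₂ : {s, t} ∪ S = S := by grind
        rwa [e₁, e₂] at this
      · have hSe : S = {s, t} := by
          rw [Finset.not_nonempty_iff_eq_empty, Finset.sdiff_eq_empty_iff_subset] at hS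
          exact hS.antisymm (by grind)
        have e : E = SimpleGraph.edge s t := by
          ext a b
          rw [SimpleGraph.edge_adj]
          constructor
          · intro hab
            have h₁ := h.mem_of_adj hab
            have h₂ := h.mem_of_adj hab.symm
            have := hab.ne
            rw [hSe] at h₁ h₂
            grind
          · have := hadj.symm
            grind
        rw [e, hSe]
        exact ⟨0, Network.edge hst, hr⟩
    by_cases hcut : ∀ w, w ≠ s → w ≠ t → (restrict E {w}ᶜ).Reachable s t
    · obtain ⟨x, hx, y, hy, hxs, hxt, hys, hyt, hxy⟩ : ∃ x ∈ S, ∃ y ∈ S, x ≠ s ∧ x ≠ t ∧ y ≠ s ∧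
          y ≠ t ∧ ¬ (restrict E {s, t}ᶜ).Reachable x y := by
        by_contra! hcon
        exact h.false_of_connected hadj hcut fun x hx y hy a b c d => hcon x hx y hy a b c d
      set C := S.filter fun z => (restrict E {s, t}ᶜ).Reachable x z with hC
      have hCst : ∀ z ∈ C, z ≠ s ∧ z ≠ t := fun z hz => by
        simpa using mem_of_reachable_restrict (Finset.mem_filter.1 hz).2 (by simp [hxs, hxt])
      have hCcl : ∀ a ∈ C, ∀ b, E.Adj a b → b ≠ s → b ≠ t → b ∈ C := by
        intro a ha b hab hbs hbt
        refine Finset.mem_filter.2 ⟨h.mem_of_adj hab.symm, (Finset.mem_filter.1 ha).2.trans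
          (SimpleGraph.Adj.reachable ⟨hab, ?_, ?_⟩)⟩
        · simpa using hCst a ha
        · simp [hbs, hbt]
      have hxC : x ∈ C := by simp [hC, hx]
      have hyC : y ∉ C := by simp [hC, hxy]
      have hCS : C ⊆ S := Finset.filter_subset _ _
      set D := S \ (C ∪ {s, t}) with hD
      have hyD : y ∈ D := by grind
      have h₁ := h.of_parallel (E' := restrict E ↑(C ∪ {s, t})) hCS ⟨x, hxC⟩ (by grind) (by grind)
        restrict_le (fun hab => Finset.mem_coe.1 hab.2.1) (fun a ha b hab => by
          refine ⟨hab, Finset.mem_coe.2 (by grind), Finset.mem_coe.2 ?_⟩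
          have := hCcl a ha b hab
          grind)
      have h₂ := h.of_parallel (E' := restrict E ↑(D ∪ {s, t})) (C := D) (by grind) ⟨y, hyD⟩
        (by grind) (by grind)
        restrict_le (fun hab => Finset.mem_coe.1 hab.2.1) (fun a ha b hab => by
          refine ⟨hab, Finset.mem_coe.2 (by grind), Finset.mem_coe.2 ?_⟩
          have := hCcl b
          have := h.mem_of_adj hab.symm
          have := hab.symm
          grind)
      obtain ⟨l₁, hl₁⟩ := h₁.exists_isLink
      obtain ⟨l₂, hl₂⟩ := h₂.exists_isLink
      have hr₁ := h₁.link_mod l₁ hl₁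
      have hr₂ := h₂.link_mod l₂ hl₂
      -- A path through each part closes a cycle, so $2r\equiv 0$ and hence $r\equiv 0$, as
      -- `Network.par` requires.
      have hcyc := h.cycle_mod s t l₁ l₂ (hl₁.mono restrict_le) (hl₂.mono restrict_le)
        (fun z hz hz' => by
          have i₁ := hl₁.mem_of_adj (S := ↑(C ∪ {s, t})) (fun a b hab => hab.2.1) (x := z)
            (by simp [hz])
          have i₂ := hl₂.mem_of_adj (S := ↑(D ∪ {s, t})) (fun a b hab => hab.2.1) (x := z)
            (by simp [hz'])
          have := hl₁.1
          rw [Finset.mem_coe] at i₁ i₂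
          grind)
        (by
          rintro rfl
          exact hadj (isLink_nil_iff.1 hl₁).1)
      have c₁ : (C ∪ {s, t}).card < S.card := Finset.card_lt_card (by
        rw [Finset.ssubset_iff_of_subset (by grind)]
        exact ⟨y, hy, by grind⟩)
      have c₂ : (D ∪ {s, t}).card < S.card := Finset.card_lt_card (by
        rw [Finset.ssubset_iff_of_subset (by grind)]
        exact ⟨x, hx, by grind⟩)
      obtain ⟨n₁, hn₁, hnr₁⟩ := ih _ (by split_ifs <;> omega) h₁ rfl
      obtain ⟨n₂, hn₂, hnr₂⟩ := ih _ (by split_ifs <;> omega) h₂ rfl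
      refine ⟨n₁ + n₂, ?_, by omega⟩
      have := hn₁.par hn₂ (by omega) (by omega) (by grind)
      have e₁ : restrict E ↑(C ∪ {s, t}) ⊔ restrict E ↑(D ∪ {s, t}) = E := by
        refine le_antisymm (sup_le restrict_le restrict_le) fun a b hab => ?_
        have ha := h.mem_of_adj hab
        have hb := h.mem_of_adj hab.symm
        have := hCcl a
        have := hCcl b
        have := hab.symm
        have hor : (a ∈ C ∪ {s, t} ∧ b ∈ C ∪ {s, t}) ∨ (a ∈ D ∪ {s, t} ∧ b ∈ D ∪ {s, t}) := by
          grind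
        exact hor.imp (fun h => ⟨hab, h.1, h.2⟩) (fun h => ⟨hab, h.1, h.2⟩)
      have e₂ : (C ∪ {s, t}) ∪ (D ∪ {s, t}) = S := by grind
      rwa [e₁, e₂] at this
    · push Not at hcut
      obtain ⟨w, hws, hwt, hw⟩ := hcut
      set R := S.filter fun z => (restrict E {w}ᶜ).Reachable s z with hR
      have hwR : w ∉ R := by
        intro hwR
        have := mem_of_reachable_restrict (Finset.mem_filter.1 hwR).2 (by simpa using hws.symm)
        simp at this
      have hcl : ∀ a ∈ R, ∀ b, E.Adj a b → b ≠ w → b ∈ R := by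
        intro a ha b hab hb
        refine Finset.mem_filter.2 ⟨h.mem_of_adj hab.symm, (Finset.mem_filter.1 ha).2.trans
          (SimpleGraph.Adj.reachable ⟨hab, ?_, ?_⟩)⟩
        · simp only [Set.mem_compl_iff, Set.mem_singleton_iff]
          grind
        · simpa using hb
      have hsR : s ∈ R := by simp [hR, hs]
      have htR : t ∉ R := by simp [hR, hw]
      have hRS : R ⊆ S := Finset.filter_subset _ _
      have hwS : w ∈ S := by
        obtain ⟨a, ha, b, hb, hab⟩ := h.exists_adj' R hRS hsR htR
        have := hcl a ha b hab
        have := h.mem_of_adj hab.symm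
        grind
      obtain ⟨r₁, r₂, h₁, h₂, hr⟩ := h.split hRS hwS hwt hsR htR hwR hcl
      have c₁ : (insert w R).card < S.card := Finset.card_lt_card (by
        rw [Finset.ssubset_iff_of_subset (by grind)]
        exact ⟨t, ht, by grind⟩)
      have c₂ : (S \ R).card < S.card := Finset.card_lt_card (by
        rw [Finset.ssubset_iff_of_subset (by grind)]
        exact ⟨s, hs, by grind⟩)
      obtain ⟨n₁, hn₁, hnr₁⟩ := ih _ (by split_ifs <;> omega) h₁ rfl
      obtain ⟨n₂, hn₂, hnr₂⟩ := ih _ (by split_ifs <;> omega) h₂ rfl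
      refine ⟨n₁ + n₂ + 1, ?_, by omega⟩
      have := hn₁.ser hn₂ (by grind)
      have e₁ : restrict E ↑(insert w R) ⊔ restrict E ↑(S \ R) = E := by
        refine le_antisymm (sup_le restrict_le restrict_le) fun a b hab => ?_
        have ha := h.mem_of_adj hab
        have hb := h.mem_of_adj hab.symm
        have := hcl a
        have := hcl b
        have := hab.symm
        have hor : (a ∈ insert w R ∧ b ∈ insert w R) ∨ (a ∈ S \ R ∧ b ∈ S \ R) := by
          grind
        exact hor.imp (fun h => ⟨hab, h.1, h.2⟩) (fun h => ⟨hab, h.1, h.2⟩)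
      have e₂ : insert w R ∪ S \ R = S := by grind
      rwa [e₁, e₂] at this

end TwoTerminal

/-! ### Cycle lengths modulo 3 and ears -/

section Cycles

variable {V : Type*} {G : SimpleGraph V}

/-- In a `(0,1)`-ternary graph every cycle, induced or not, has length `2` modulo `3`: a chord
splits a cycle into two shorter ones. -/
theorem IsZeroOneTernary.length_mod (h : IsZeroOneTernary G) {a : V} {c : G.Walk a a}
    (hc : c.IsCycle) : c.length % 3 = 2 := by
  classical
  induction hk : c.length using Nat.strong_induction_on generalizing a c with
  | _ k ih =>
    subst hk
    by_cases hch : c.IsChordless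
    · have := h a c hc hch
      omega
    rw [SimpleGraph.Walk.isChordless_iff_forall_mem_edges] at hch
    push Not at hch
    obtain ⟨x, y, hx, hy, hxy, he⟩ := hch
    have hd := hc.rotate hx
    have hy' : y ∈ (c.rotate x hx).support := (SimpleGraph.Walk.mem_support_rotate_iff ..).2 hy
    have he' : s(x, y) ∉ (c.rotate x hx).edges := fun h' => he ((c.rotate_edges x hx).mem_iff.1 h')
    have hl : (c.rotate x hx).length = c.length := SimpleGraph.Walk.length_rotate ..
    generalize c.rotate x hx = d at hd hy' he' hl
    have hspec := d.take_spec hy'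
    have hp : (d.takeUntil y hy').IsPath := hd.isPath_takeUntil hy'
    have hq : (d.dropUntil y hy').IsPath := by
      refine SimpleGraph.Walk.IsCycle.isPath_of_append_right (p := d.takeUntil y hy') ?_ ?_
      · exact SimpleGraph.Walk.not_nil_of_ne hxy.ne
      · rwa [hspec]
    have hp' : s(x, y) ∉ (d.takeUntil y hy').edges := fun h' =>
      he' (d.edges_takeUntil_subset_edges hy' h')
    have hq' : s(x, y) ∉ (d.dropUntil y hy').edges := fun h' =>
      he' (d.edges_dropUntil_subset_edges hy' h')
    have hlen : (d.takeUntil y hy').length + (d.dropUntil y hy').length = d.length := by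
      rw [← SimpleGraph.Walk.length_append, hspec]
    have c₁ : (SimpleGraph.Walk.cons hxy.symm (d.takeUntil y hy')).IsCycle :=
      (SimpleGraph.Walk.cons_isCycle_iff _ _).2 ⟨hp, by rwa [Sym2.eq_swap]⟩
    have c₂ : (SimpleGraph.Walk.cons hxy (d.dropUntil y hy')).IsCycle :=
      (SimpleGraph.Walk.cons_isCycle_iff _ _).2 ⟨hq, hq'⟩
    have t₁ := c₁.three_le_length
    have t₂ := c₂.three_le_length
    simp only [SimpleGraph.Walk.length_cons] at t₁ t₂
    have i₁ := ih _ (by simp only [SimpleGraph.Walk.length_cons]; omega) c₁ rfl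
    have i₂ := ih _ (by simp only [SimpleGraph.Walk.length_cons]; omega) c₂ rfl
    simp only [SimpleGraph.Walk.length_cons] at i₁ i₂
    -- The chord is counted in both cycles, so their lengths add up to `c.length + 2`.
    omega

theorem IsLink.exists_walk {u v : V} {l : List V} (h : IsLink G u l v) :
    ∃ p : G.Walk u v, p.IsPath ∧ p.length = l.length + 1 := by
  have key : ∃ p : G.Walk u v, p.support = u :: (l ++ [v]) := by
    induction l generalizing u with
    | nil => exact ⟨(isLink_nil_iff.1 h).toWalk, by simp⟩
    | cons a l ih =>
      obtain ⟨hua, hav, -⟩ := IsLink.split (l := []) h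
      obtain ⟨p, hp⟩ := ih hav
      exact ⟨.cons (isLink_nil_iff.1 hua) p, by simp [hp]⟩
  obtain ⟨p, hp⟩ := key
  refine ⟨p, (SimpleGraph.Walk.isPath_def p).2 (hp ▸ h.1), ?_⟩
  have := p.length_support
  rw [hp] at this
  simpa using this.symm

/-- Two internally disjoint paths between the same vertices form a cycle. -/
theorem IsZeroOneTernary.length_add_length_mod (h : IsZeroOneTernary G) {u v : V} {A B : List V}
    (hA : IsLink G u A v) (hB : IsLink G u B v) (hAB : ∀ x ∈ A, x ∉ B) (hne : A ≠ []) :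
    (A.length + B.length) % 3 = 0 := by
  rcases A with _ | ⟨a, A⟩
  · exact absurd rfl hne
  obtain ⟨hua, hav, -⟩ := IsLink.split (l := []) hA
  have n₁ := hA.1
  have n₂ := hB.1
  obtain ⟨p, hp, hl⟩ := (hav.append hB.reverse (by grind)).exists_walk
  have hc : (SimpleGraph.Walk.cons (isLink_nil_iff.1 hua) p).IsCycle := by
    refine (SimpleGraph.Walk.cons_isCycle_iff _ _).2 ⟨hp, fun he => ?_⟩
    have := hp.length_eq_one_of_mem_edges (by rwa [Sym2.eq_swap])
    simp at hl
    omega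
  have := h.length_mod hc
  simp only [SimpleGraph.Walk.length_cons, hl, List.length_append, List.length_cons,
    List.length_reverse] at this ⊢
  omega

theorem exists_adj_of_reachable {C : Set V} {u v : V} (h : G.Reachable u v) (hu : u ∈ C)
    (hv : v ∉ C) : ∃ a ∈ C, ∃ b, b ∉ C ∧ G.Adj a b := by
  obtain ⟨p⟩ := h
  obtain ⟨d, -, h₁, h₂⟩ := p.exists_boundary_dart C hu hv
  exact ⟨_, h₁, _, h₂, d.adj⟩

theorem IsTwoConnected.isTwoTerminal [Fintype V] (h : IsTwoConnected G) (h' : IsZeroOneTernary G)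
    {s t : V} {r : ℕ} (hst : s ≠ t) (hr : ∀ l, IsLink G s l t → l.length % 3 = r % 3) :
    IsTwoTerminal G Finset.univ s t r where
  ne := hst
  left_mem := Finset.mem_univ _
  right_mem := Finset.mem_univ _
  mem_of_adj _ := Finset.mem_univ _
  exists_adj C _ hC hs ht x := by
    obtain ⟨c, hc⟩ := hC
    by_cases hx : x ∈ C
    · obtain ⟨a, ha, b, hb, hab⟩ := exists_adj_of_reachable (C := (C : Set V))
        (h.2.1.preconnected c s) hc (by simpa using hs)
      exact ⟨a, ha, b, hb, fun e => hb (e ▸ hx), hab⟩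
    -- One of the two terminals survives the deletion of `x`, and `G - x` is connected.
    · obtain ⟨z, hzx, hz⟩ : ∃ z, z ≠ x ∧ z ∉ C := by
        by_cases hsx : s = x
        · exact ⟨t, fun e => hst (hsx.trans e.symm), ht⟩
        · exact ⟨s, hsx, hs⟩
      obtain ⟨a, ha, b, hb, hab⟩ := exists_adj_of_reachable
        (C := (Subtype.val ⁻¹' (C : Set V) : Set ({x}ᶜ : Set V)))
        ((h.2.2 x).preconnected ⟨c, fun e => hx (e ▸ hc)⟩ ⟨z, hzx⟩) hc hz
      exact ⟨a, ha, b, hb, b.2, hab⟩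
  exists_adj' C _ hs ht := exists_adj_of_reachable (C := (C : Set V))
    (h.2.1.preconnected s t) hs ht
  link_mod := hr
  cycle_mod _ _ _ _ hA hB hAB hne := h'.length_add_length_mod hA hB hAB hne

/-- The vertex count alone fixes the number of internal vertices, whatever `r` is. -/
theorem IsTwoConnected.network [Fintype V] [DecidableEq V] (h : IsTwoConnected G)
    (h' : IsZeroOneTernary G) {m : ℕ} (hm : Fintype.card V = 3 * m + 2)
    {s t : V} {r : ℕ} (hst : s ≠ t) (hr : ∀ l, IsLink G s l t → l.length % 3 = r % 3) :
    Network G Finset.univ s t (3 * m) := by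
  obtain ⟨n, hn, -⟩ := (h.isTwoTerminal h' hst hr).exists_network
  have := hn.card_eq
  rw [Finset.card_univ, hm] at this
  obtain rfl : n = 3 * m := by omega
  exact hn

theorem IsTwoConnected.network_of_adj [Fintype V] [DecidableEq V] (h : IsTwoConnected G)
    (h' : IsZeroOneTernary G) {m : ℕ} (hm : Fintype.card V = 3 * m + 2)
    {s t : V} (hst : G.Adj s t) : Network G Finset.univ s t (3 * m) := by
  refine h.network h' hm hst.ne (r := 0) fun l hl => ?_
  by_cases hne : l = []
  · simp [hne]
  · have := h'.length_add_length_mod hl (isLink_nil_iff.2 hst) (by simp) hne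
    simpa using this

theorem IsTwoConnected.exists_adj (h : IsTwoConnected G) (x : V) : ∃ y, G.Adj x y := by
  obtain ⟨hV, hc, -⟩ := h
  exact hc.preconnected.exists_adj_of_nontrivial x

theorem isLink_attachEar (u v : V) (n : ℕ) (huv : u ≠ v) :
    IsLink (attachEar G u v n) (Sum.inl u) ((List.finRange n).map Sum.inr) (Sum.inl v) := by
  constructor
  · simp [List.nodup_append, huv, List.nodup_finRange, List.nodup_map_iff Sum.inr_injective]
  · rw [List.isChain_iff_getElem]
    intro i hi
    simp only [List.length_cons, List.length_append, List.length_map, List.length_finRange,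
      List.length_nil] at hi
    rw [attachEar, SimpleGraph.fromRel_adj]
    simp only [List.getElem_cons, List.getElem_append, List.getElem_map, List.getElem_finRange,
      List.length_map, List.length_finRange]
    rcases Nat.eq_zero_or_pos i with rfl | h0
    · rcases Nat.eq_zero_or_pos n with rfl | hn
      · simp [huv]
      · simp [hn]
    · by_cases hin : i < n
      · simp [h0.ne', hin, show i - 1 < n by omega]
        omega
      · obtain rfl : i = n := by omega
        simp [h0.ne', h0]
        omega

theorem IsLink.attachEar {u v a b : V} {l : List V} (n : ℕ) (h : IsLink G a l b) :
    IsLink (attachEar G u v n) (Sum.inl a) (l.map Sum.inl) (Sum.inl b) := by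
  have e : (Sum.inl a :: (l.map Sum.inl ++ [Sum.inl b]) : List (V ⊕ Fin n)) =
      (a :: (l ++ [b])).map Sum.inl := by simp
  refine ⟨?_, ?_⟩
  · rw [e, List.nodup_map_iff Sum.inl_injective]
    exact h.1
  · rw [e]
    refine List.isChain_map_of_isChain _ (fun x y hxy => ?_) h.2
    rw [ZeroOneTernary.attachEar, SimpleGraph.fromRel_adj]
    simp [hxy, hxy.ne]

theorem IsAdmissiblePair.network [Fintype V] [DecidableEq V] (h : IsTwoConnected G)
    (h' : IsZeroOneTernary G) {m : ℕ} (hm : Fintype.card V = 3 * m + 2)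
    {u v : V} (huv : IsAdmissiblePair G u v) : Network G Finset.univ u v (3 * m) := by
  obtain ⟨hne, n, hn, -, h01⟩ := huv
  -- Closing a path by the ear gives $|l|+n\equiv 0$, and $-n\equiv 2n$ modulo $3$.
  refine h.network h' hm hne (r := 2 * n) fun l hl => ?_
  have key : l ≠ [] ∨ n ≠ 0 := by
    by_contra! hcon
    obtain ⟨rfl, rfl⟩ := hcon
    exact hn rfl (isLink_nil_iff.1 hl)
  have : (l.length + n) % 3 = 0 := by
    rcases key with hl' | hn'
    · have := h01.length_add_length_mod (hl.attachEar n) (isLink_attachEar u v n hne) (by simp)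
        (by simpa using hl')
      simpa using this
    · have := h01.length_add_length_mod (isLink_attachEar u v n hne) (hl.attachEar n) (by simp)
        (by
          intro e
          have := congrArg List.length e
          simp at this
          exact hn' this)
      simp only [List.length_map, List.length_finRange] at this
      omega
  omega

end Cycles

/-! ### Bounds for independent dominating sets -/

section Bounds

theorem card_eq_card_sdiff_pair {V : Type*} [DecidableEq V] {J : Finset V} {s t : V} (hst : s ≠ t) : J.card =
    (J \ {s, t}).card + (if s ∈ J then 1 else 0) + (if t ∈ J then 1 else 0) := by
  have e := Finset.card_sdiff_add_card_inter J {s, t}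
  have : (J ∩ {s, t}).card = (if s ∈ J then 1 else 0) + (if t ∈ J then 1 else 0) := by
    rw [Finset.inter_comm]
    split_ifs with h₁ h₂ h₂
    · rw [Finset.inter_eq_left.2 (by grind), Finset.card_pair hst]
    · rw [show ({s, t} : Finset V) ∩ J = {s} by grind, Finset.card_singleton]
    · rw [show ({s, t} : Finset V) ∩ J = {t} by grind, Finset.card_singleton]
    · rw [show ({s, t} : Finset V) ∩ J = ∅ by grind, Finset.card_empty]
  omega

theorem status_ne_zero_iff {V : Type*} [DecidableEq V] {G : SimpleGraph V} {J : Finset V} {v : V} : status G J v ≠ 0 ↔ v ∈ J ∨ ∃ w ∈ J, G.Adj v w := by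
  rw [Ne, status_eq_zero]
  grind

variable {V : Type*} [Fintype V] [DecidableEq V] {G : SimpleGraph V} {s t : V} {m : ℕ}
  {J : Finset V}

/-- Domination of `s` is not required, so that dominating sets of the graph without `s` are covered
too. -/
theorem Network.le_card_of_dominating (h : Network G Finset.univ s t (3 * m))
    (hJ : G.IsIndepSet (J : Set V)) (hd : ∀ v, v ≠ s → v ∈ J ∨ ∃ w ∈ J, G.Adj v w) :
    m + 1 ≤ J.card ∧ (s ∈ J → t ∈ J → m + 2 ≤ J.card) := by
  have hc : IsConfig G Finset.univ s t J :=
    ⟨Finset.subset_univ _, fun a ha b hb hab => hJ ha hb hab.ne hab,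
      fun v _ hv _ => status_ne_zero_iff.2 (hd v hv)⟩
  have hle := h.le_card hc
  have ht : status G J t ≠ 0 := status_ne_zero_iff.2 (hd t h.ne.symm)
  have hcard := card_eq_card_sdiff_pair (J := J) h.ne
  rw [show 3 * m % 3 = 0 by omega, show 3 * m / 3 = m by omega] at hle
  -- Beyond `m` vertices, either a terminal is chosen or `t` is dominated from inside, at the cost
  -- of one extra internal vertex.
  have tab : ∀ a b : Fin 3, b ≠ 0 →
      1 ≤ excess 0 a b + (if a = 2 then 1 else 0) + (if b = 2 then 1 else 0) := by decide
  have := tab (status G J s) (status G J t) ht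
  simp only [status_eq_two] at this
  refine ⟨by omega, fun h₁ h₂ => ?_⟩
  rw [if_pos h₁, if_pos h₂] at hcard
  omega

/-- The tight status pair `(2, 1)` has excess $0$: `m` internal vertices and `s` suffice. -/
theorem Network.exists_isIndepDominating (h : Network G Finset.univ s t (3 * m)) :
    ∃ J : Finset V, IsIndepDominating G J ∧ s ∈ J ∧ J.card ≤ m + 1 := by
  obtain ⟨J, hJ, hs, ht, hle⟩ := h.exists_isConfig (a := 2) (b := 1)
    (by rw [show 3 * m % 3 = 0 by omega]; decide)
  rw [show 3 * m % 3 = 0 by omega, show 3 * m / 3 = m by omega] at hle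
  have hsJ := status_eq_two.1 hs
  have htJ := (status_eq_one.1 ht).1
  have hcard := card_eq_card_sdiff_pair (J := J) h.ne
  rw [if_pos hsJ, if_neg htJ] at hcard
  refine ⟨J, ⟨fun a ha b hb _ => hJ.indep a ha b hb, fun v => ?_⟩, hsJ, ?_⟩
  · by_cases hvs : v = s
    · exact Or.inl (hvs ▸ hsJ)
    by_cases hvt : v = t
    · rw [← status_ne_zero_iff, hvt, ht]
      decide
    · exact status_ne_zero_iff.1 (hJ.dom v (Finset.mem_univ v) hvs hvt)
  · have : excess 0 2 1 = 0 := rfl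
    omega

theorem exists_card_eq_indepDomNumber {W : Type*} [Finite W] (H : SimpleGraph W) :
    ∃ A : Finset W, IsIndepDominating H A ∧ A.card = indepDomNumber H := by
  obtain ⟨A, hA⟩ := ZeroOneTernary.exists_isIndepDominating H
  exact Nat.sInf_mem (s := {k : ℕ | ∃ A : Finset W, IsIndepDominating H A ∧ A.card = k})
    ⟨_, A, hA, rfl⟩

theorem IsIndepDominating.indepDomNumber_le {W : Type*} {H : SimpleGraph W} {A : Finset W}
    (hA : IsIndepDominating H A) : indepDomNumber H ≤ A.card :=
  Nat.sInf_le ⟨A, hA, rfl⟩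

end Bounds
end ZeroOneTernary

theorem theorem3p2 {V : Type*} [Fintype V] (G : SimpleGraph V) (m : ℕ)
    (h2 : ZeroOneTernary.IsTwoConnected G) (h01 : ZeroOneTernary.IsZeroOneTernary G)
    (hcard : Fintype.card V = 3 * m + 2) :
    ZeroOneTernary.indepDomNumber G = m + 1 ∧
    (∀ I : Finset V, ZeroOneTernary.IsMinIndepDominating G I →
      ¬ ∃ u ∈ I, ∃ v ∈ I, ZeroOneTernary.IsAdmissiblePair G u v) ∧
    (∀ x : V, ZeroOneTernary.indepDomNumber G ≤
      ZeroOneTernary.indepDomNumber (ZeroOneTernary.deleteVertex G x)) ∧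
    (∀ x : V, ∃ I : Finset V, ZeroOneTernary.IsMinIndepDominating G I ∧ x ∈ I) := by
  classical
  have network : ∀ x, ∃ y, ZeroOneTernary.Network G Finset.univ x y (3 * m) := fun x =>
    let ⟨y, hy⟩ := h2.exists_adj x
    ⟨y, h2.network_of_adj h01 hcard hy⟩
  have lower : ∀ A : Finset V, ZeroOneTernary.IsIndepDominating G A → m + 1 ≤ A.card := by
    intro A hA
    obtain ⟨x⟩ := h2.2.1.nonempty
    obtain ⟨y, hy⟩ := network x
    exact (hy.le_card_of_dominating hA.1 fun v _ => hA.2 v).1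
  have upper : ∀ x, ∃ A : Finset V, ZeroOneTernary.IsIndepDominating G A ∧ x ∈ A ∧
      A.card ≤ m + 1 := by
    intro x
    obtain ⟨y, hy⟩ := network x
    exact hy.exists_isIndepDominating
  have number : ZeroOneTernary.indepDomNumber G = m + 1 := by
    obtain ⟨x⟩ := h2.2.1.nonempty
    obtain ⟨A, hA, -, hle⟩ := upper x
    obtain ⟨B, hB, hBc⟩ := ZeroOneTernary.exists_card_eq_indepDomNumber G
    exact le_antisymm (hA.indepDomNumber_le.trans hle) (hBc ▸ lower B hB)
  refine ⟨number, ?_, fun x => ?_, fun x => ?_⟩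
  · rintro I ⟨hI, hmin⟩ ⟨u, hu, v, hv, huv⟩
    have := ((huv.network h2 h01 hcard).le_card_of_dominating hI.1 fun v _ => hI.2 v).2 hu hv
    obtain ⟨A, hA, -, hle⟩ := upper u
    have := hmin A hA
    omega
  · obtain ⟨y, hy⟩ := network x
    obtain ⟨B, hB, hBc⟩ := ZeroOneTernary.exists_card_eq_indepDomNumber
      (ZeroOneTernary.deleteVertex G x)
    rw [number, ← hBc, ← Finset.card_map (Function.Embedding.subtype _)]
    -- Viewed in `G`, the set `B` may fail to dominate only `x`, the exempt terminal.
    refine (hy.le_card_of_dominating ?_ fun v hv => ?_).1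
    · intro a ha b hb hab hadj
      obtain ⟨a', ha', rfl⟩ := Finset.mem_map.1 (Finset.mem_coe.1 ha)
      obtain ⟨b', hb', rfl⟩ := Finset.mem_map.1 (Finset.mem_coe.1 hb)
      exact hB.1 ha' hb' (fun e => hab (congrArg _ e)) hadj
    · rcases hB.2 ⟨v, hv⟩ with h | ⟨w, hw, hvw⟩
      · exact Or.inl (Finset.mem_map.2 ⟨_, h, rfl⟩)
      · exact Or.inr ⟨w, Finset.mem_map.2 ⟨w, hw, rfl⟩, hvw⟩
  · obtain ⟨A, hA, hx, hle⟩ := upper x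
    exact ⟨A, ⟨hA, fun B hB => hle.trans (lower B hB)⟩, hx⟩
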